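/- For oriented link diagrams, let $\nabla$ be the Conway polynomial: the isotopy invariant of oriented links with values in $\mathbb Z[z]$ such that $\nabla_O=1$ for the unknot $O$ and $\nabla_{L_+}-\nabla_{L_-}=z\nabla_{L_0}$ for diagrams that differ only by a positive crossing, a negative crossing and its oriented smoothing. For an integer $k$ let $k\epsilon$ denote the oriented tangle made of two vertical strands with $k$ half-twists (right-handed if $k>0$, left-handed if $k<0$, so that for $k>0$ its crossings are positive if the strands are parallel and, if they are antiparallel, negative), where $\epsilon={\uparrow\downarrow}$ if the two strands are antiparallel and $\epsilon={\uparrow\uparrow}$ if they are parallel. Let $\infty{\uparrow\downarrow}$ (resp. $\infty {\uparrow\uparrow}$) be the crossingless tangle consisting of one arc joining the two top ends and one arc joining the two bottom ends, with opposite (resp. equal) left-right directions. Let $L(k_1\epsilon_1,k_2\epsilon_2)$ be an oriented link diagram containing, inside a disc, the sum of the two tangles $k_1\epsilon_1$ and $k_2\epsilon_2$: the right top (resp. right bottom) end of the first is joined to the left top (resp. left bottom) end of the second. Let $L(\infty\epsilon)$ be the diagram that is identical to it outside the disc and has $\infty\epsilon$ inside it, the orientations being compatible. Let $\tau(k\epsilon)$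 be the $(2,k)$-torus link obtained from $k\epsilon$ by joining its two left ends by an arc and its two right ends by an arc. For an integer $p$ put $$\Phi(p,z)=\sum_{i\ge 0}\binom{p+i}{2i+1}z^{2i+1},\qquad \Psi(p,z)=\sum_{i\ge 0}\binom{p+i}{2i}z^{2i},$$ where $\binom{\alpha}{n}=\alpha(\alpha-1)\cdots(\alpha-n+1)/n!$; both sums are finite. Then for every integer $p$ and every such family of diagrams: 1. $\nabla_{L(2p{\uparrow\downarrow},\,-2p{\uparrow\downarrow})}=\nabla_{\tau(2p{\uparrow\downarrow})}\nabla_{\tau(-2p{\uparrow\downarrow})}\nabla_{L(\infty{\uparrow\downarrow})}=-p^2z^2\,\nabla_{L(\infty{\uparrow\downarrow})}$; 2. $\nabla_{L((2p+1){\uparrow\downarrow},\,-(2p+1){\uparrow\downarrow})}=(1-p(p+1)z^2)\,\nabla_{L(\infty {\uparrow\uparrow})}$; 3. $\nabla_{L(2p{\uparrow\uparrow},\,-2p{\uparrow\uparrow})}=\nabla_{\tau(2p{\uparrow\uparrow})}\nabla_{\tau(-2p{\uparrow\uparrow})}\nabla_{L(\infty{\uparrow\downarrow})}=-\Phi(p,z)^2\,\nabla_{L(\infty{\uparrow\downarrow})}$;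 4. $\nabla_{L((2p+1){\uparrow\uparrow},\,-(2p+1){\uparrow\uparrow})}=\nabla_{\tau((2p+1){\uparrow\uparrow})}\nabla_{\tau(-(2p+1){\uparrow\uparrow})}\nabla_{L(\infty{\uparrow\downarrow})}=\Psi(p,z)^2\,\nabla_{L(\infty{\uparrow\downarrow})}$. -/

import Mathlib

open Polynomial

namespace LinkDiag

/-! ### Oriented tangle and link diagrams in Morse position

A generic oriented diagram in the plane is cut by horizontal lines into elementary layers, each
holding one crossing, one minimum or one maximum next to vertical strands; it is recorded as the
list of its layers, read from bottom to top.  A horizontal level is recorded by the list of the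
directions of the strands meeting it, from left to right: `true` is upward, `false` downward. -/

/-- The elementary pieces of a diagram. -/
inductive Gen : Type
  /-- A crossing. The strand from bottom left to top right has direction `a`, the strand from
  bottom right to top left has direction `b`; the former is the over-strand iff `o = true`. -/
  | cross (o a b : Bool) : Gen
  /-- A minimum, whose left leg has direction `a`. -/
  | cup (a : Bool) : Gen
  /-- A maximum, whose left leg has direction `a`. -/
  | cap (a : Bool) : Gen

/-- The strands at the bottom of an elementary piece. -/
def Gen.src : Gen → List Bool
  | .cross _ a b => [a, b]
  | .cup _ => []
  | .cap a => [a, !a]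

/-- The strands at the top of an elementary piece. -/
def Gen.tgt : Gen → List Bool
  | .cross _ a b => [b, a]
  | .cup a => [a, !a]
  | .cap _ => []

/-- An elementary piece with vertical strands to its left and to its right. -/
structure Layer : Type where
  left : List Bool
  gen : Gen
  right : List Bool

def Layer.src (L : Layer) : List Bool := L.left ++ L.gen.src ++ L.right

def Layer.tgt (L : Layer) : List Bool := L.left ++ L.gen.tgt ++ L.right

/-- Add the vertical strands `l` on the left and `r` on the right. -/
def Layer.shift (l r : List Bool) (L : Layer) : Layer := ⟨l ++ L.left, L.gen, L.right ++ r⟩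

/-- The layers `w`, stacked from bottom to top, fit together to a tangle diagram with bottom ends
`s` and top ends `t`. -/
def IsTangle : List Bool → List Layer → List Bool → Prop
  | s, [], t => s = t
  | s, L :: w, t => s = L.src ∧ IsTangle L.tgt w t

theorem IsTangle.append {w w' : List Layer} :
    ∀ {s t u : List Bool}, IsTangle s w t → IsTangle t w' u → IsTangle s (w ++ w') u := by
  induction w with
  | nil => intro s t u h h'; cases h; exact h'
  | cons L w ih => intro s t u h h'; exact ⟨h.1, ih h.2 h'⟩

theorem IsTangle.shift (l r : List Bool) {w : List Layer} :
    ∀ {s t : List Bool}, IsTangle s w t →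
      IsTangle (l ++ s ++ r) (w.map (Layer.shift l r)) (l ++ t ++ r) := by
  induction w with
  | nil => intro s t h; cases h; rfl
  | cons L w ih =>
    intro s t h
    refine ⟨?_, ?_⟩
    · rw [h.1]; simp [Layer.src, Layer.shift, List.append_assoc]
    · have := ih h.2
      simpa [Layer.tgt, Layer.shift, List.append_assoc] using this

/-- Oriented tangle diagrams with bottom ends `s` and top ends `t`. -/
def Tangle (s t : List Bool) : Type := {w : List Layer // IsTangle s w t}

/-- Oriented link diagrams: tangle diagrams without ends. -/
abbrev LinkDiagram : Type := Tangle [] []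

/-- The part of an oriented link diagram outside a disc that the link meets in the bottom ends `s`
and the top ends `t`: the part below, the vertical strands on both sides, and the part above. -/
structure Outside (s t : List Bool) : Type where
  left : List Bool
  right : List Bool
  below : Tangle [] (left ++ s ++ right)
  above : Tangle (left ++ t ++ right) []

/-- The link diagram obtained by filling the disc with the tangle diagram `T`. -/
def Outside.fill {s t : List Bool} (O : Outside s t) (T : Tangle s t) : LinkDiagram :=
  ⟨O.below.1 ++ (T.1.map (Layer.shift O.left O.right) ++ O.above.1),
    O.below.2.append ((T.2.shift O.left O.right).append O.above.2)⟩

/-! ### Isotopy -/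

/-- The local moves that generate isotopy of oriented links: the planar isotopies of diagrams in
Morse position and the three Reidemeister moves, for all orientations. -/
inductive Move : List Layer → List Layer → Prop
  /-- Exchanging the heights of two distant pieces. -/
  | exchange (l m r : List Bool) (g h : Gen) :
      Move [⟨l, g, m ++ h.src ++ r⟩, ⟨l ++ g.tgt ++ m, h, r⟩]
        [⟨l ++ g.src ++ m, h, r⟩, ⟨l, g, m ++ h.tgt ++ r⟩]
  /-- Straightening a strand (two mirror images). -/
  | zigzagRight (a : Bool) : Move [⟨[a], .cup (!a), []⟩, ⟨[], .cap a, [a]⟩] []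
  | zigzagLeft (a : Bool) : Move [⟨[], .cup a, [a]⟩, ⟨[a], .cap (!a), []⟩] []
  /-- Passing a maximum or a minimum over or under a strand. -/
  | slideCap (o a b : Bool) :
      Move [⟨[], .cross o a b, [!a]⟩, ⟨[b], .cap a, []⟩]
        [⟨[a], .cross (!o) b (!a), []⟩, ⟨[], .cap a, [b]⟩]
  | slideCup (o a b : Bool) :
      Move [⟨[b], .cup a, []⟩, ⟨[], .cross o b a, [!a]⟩]
        [⟨[], .cup a, [b]⟩, ⟨[a], .cross (!o) (!a) b, []⟩]
  /-- The first Reidemeister move. -/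
  | reidemeisterOneCup (o a : Bool) :
      Move [⟨[], .cup a, []⟩, ⟨[], .cross o a (!a), []⟩] [⟨[], .cup (!a), []⟩]
  | reidemeisterOneCap (o a : Bool) :
      Move [⟨[], .cross o a (!a), []⟩, ⟨[], .cap (!a), []⟩] [⟨[], .cap a, []⟩]
  /-- The second Reidemeister move. -/
  | reidemeisterTwo (o a b : Bool) :
      Move [⟨[], .cross o a b, []⟩, ⟨[], .cross (!o) b a, []⟩] []
  /-- The third Reidemeister move: `o₁`, `o₂`, `o₃` say whether `a` passes over `b`, `a` over `c`,
  `b` over `c`, and the condition excludes the two cyclic patterns. -/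
  | reidemeisterThree (o₁ o₂ o₃ a b c : Bool) (ho : o₂ = o₁ ∨ o₂ = o₃) :
      Move [⟨[], .cross o₁ a b, [c]⟩, ⟨[b], .cross o₂ a c, []⟩, ⟨[], .cross o₃ b c, [a]⟩]
        [⟨[a], .cross o₃ b c, []⟩, ⟨[], .cross o₂ a c, [b]⟩, ⟨[c], .cross o₁ a b, []⟩]

/-- Two link diagrams differ by one local move inside a disc. -/
inductive Step : LinkDiagram → LinkDiagram → Prop
  | mk {s t : List Bool} (O : Outside s t) (T T' : Tangle s t) (h : Move T.1 T'.1) :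
      Step (O.fill T) (O.fill T')

/-- Two link diagrams represent equivalent oriented links. -/
def Isotopic : LinkDiagram → LinkDiagram → Prop := Relation.EqvGen Step

/-! ### Elementary tangles and the Conway axioms -/

/-- Two vertical strands. -/
def vertical (a b : Bool) : Tangle [a, b] [a, b] := ⟨[], rfl⟩

/-- A single crossing of two upward strands; it is positive iff `o = true`. -/
def upCrossing (o : Bool) : Tangle [true, true] [true, true] :=
  ⟨[⟨[], .cross o true true, []⟩], rfl, rfl⟩

/-- The round circle. -/
def circle : LinkDiagram := ⟨[⟨[], .cup true, []⟩, ⟨[], .cap true, []⟩], rfl, rfl, rfl⟩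

/-- The axioms that characterize the Conway polynomial of (nonempty) oriented links. -/
structure IsConway (N : LinkDiagram → ℤ[X]) : Prop where
  isotopy : ∀ D D' : LinkDiagram, Isotopic D D' → N D = N D'
  unknot : N circle = 1
  skein : ∀ O : Outside [true, true] [true, true],
    N (O.fill (upCrossing true)) - N (O.fill (upCrossing false)) =
      X * N (O.fill (vertical true true))

/-! ### Existence of the Conway polynomial

The rest of this section only serves to prove `exists_isConway`. Levels are labelled by
`List Bool`, and the layers act on functions on labellings by a solution of the Yang-Baxter
equation over a ring with elements `q`, `r` such that `q * r = 1`. -/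

section Existence

variable {A : Type} [CommRing A]

/-- The weight of a labelling that is constant along both strands of a crossing. -/
def swapW (q r : A) : Bool → Bool → Bool → A
  | true, false, false => q
  | true, true, true => -r
  | false, false, false => r
  | false, true, true => -q
  | _, _, _ => 1

/-- The weight of the other labellings. -/
def turnW (q r : A) : Bool → Bool → Bool → Bool → Bool → A
  | true, true, true, true, false => q - r
  | false, true, true, false, true => r - q
  | true, false, false, false, true => q - r
  | false, false, false, true, false => r - q
  | false, true, false, false, false => q - r
  | true, true, false, true, true => r - q
  | false, false, true, true, true => r - q
  | true, false, true, false, false => q - r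
  | _, _, _, _, _ => 0

def cupW (r : A) : Bool → Bool → A
  | true, false => r
  | true, true => -r
  | false, _ => 1

def capW (q : A) : Bool → Bool → A
  | false, false => q
  | false, true => -q
  | true, _ => 1

def frontFun (q r : A) : Gen → (List Bool → A) → List Bool → A
  | .cross o a b, f, i :: j :: x =>
      swapW q r (o == (a == b)) i j * f (j :: i :: x) +
      turnW q r o a b i j * f ((bif a == b then i else !j) :: (bif a == b then j else !i) :: x)
  | .cross _ _ _, _, [_] => 0
  | .cross _ _ _, _, [] => 0
  | .cup a, f, x => cupW r a false * f (false :: false :: x) + cupW r a true * f (true :: true :: x)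
  | .cap a, f, i :: j :: x => if i = j then capW q a i * f x else 0
  | .cap _, _, [_] => 0
  | .cap _, _, [] => 0

def front (q r : A) (g : Gen) : (List Bool → A) →ₗ[A] (List Bool → A) where
  toFun := frontFun q r g
  map_add' f f' := by
    funext x
    rcases g with ⟨o, a, b⟩ | a | a <;> rcases x with _ | ⟨i, _ | ⟨j, x⟩⟩ <;>
      simp only [frontFun, Pi.add_apply] <;> try split_ifs
    all_goals ring
  map_smul' c f := by
    funext x
    rcases g with ⟨o, a, b⟩ | a | a <;> rcases x with _ | ⟨i, _ | ⟨j, x⟩⟩ <;>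
      simp only [frontFun, Pi.smul_apply, smul_eq_mul, RingHom.id_apply] <;> try split_ifs
    all_goals ring

def tailFun (H : (List Bool → A) →ₗ[A] (List Bool → A)) (f : List Bool → A) : List Bool → A
  | [] => 0
  | i :: x => H (fun y => f (i :: y)) x

def tail (H : (List Bool → A) →ₗ[A] (List Bool → A)) :
    (List Bool → A) →ₗ[A] (List Bool → A) where
  toFun := tailFun H
  map_add' f f' := by
    funext x
    rcases x with _ | ⟨i, x⟩
    · simp [tailFun]
    · exact congrFun (H.map_add (fun y => f (i :: y)) (fun y => f' (i :: y))) x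
  map_smul' c f := by
    funext x
    rcases x with _ | ⟨i, x⟩
    · simp [tailFun]
    · exact congrFun (H.map_smul c (fun y => f (i :: y))) x

def layerOp (q r : A) : List Bool → Gen → (List Bool → A) →ₗ[A] (List Bool → A)
  | [], g => front q r g
  | _ :: l, g => tail (layerOp q r l g)

def pull (q r : A) : List Layer → (List Bool → A) →ₗ[A] (List Bool → A)
  | [] => LinearMap.id
  | L :: w => (layerOp q r L.left L.gen).comp (pull q r w)

theorem pull_append (q r : A) (w w' : List Layer) (f : List Bool → A) :
    pull q r (w ++ w') f = pull q r w (pull q r w' f) := by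
  induction w with
  | nil => rfl
  | cons L w ih => simp [pull, ih]

theorem pull_shift_nil (q r : A) (r' : List Bool) (w : List Layer) (f : List Bool → A) :
    pull q r (w.map (Layer.shift [] r')) f = pull q r w f := by
  induction w with
  | nil => rfl
  | cons L w ih => simp [pull, ih, Layer.shift]

theorem pull_shift_cons (q r : A) (a : Bool) (l r' : List Bool) (w : List Layer)
    (f : List Bool → A) (i : Bool) (x : List Bool) :
    pull q r (w.map (Layer.shift (a :: l) r')) f (i :: x) =
      pull q r (w.map (Layer.shift l r')) (fun y => f (i :: y)) x := by
  induction w generalizing x i with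
  | nil => rfl
  | cons L w ih =>
    simp only [List.map_cons, pull, Layer.shift, List.cons_append, layerOp,
      LinearMap.comp_apply]
    change layerOp q r (l ++ L.left) L.gen _ x = _
    exact congrArg (fun g => layerOp q r (l ++ L.left) L.gen g x) (funext fun y => ih i y)

/-- Labellings of the wrong length do not matter. -/
theorem layerOp_congr (q r : A) (g : Gen) (l r' : List Bool) (f f' : List Bool → A)
    (h : ∀ y, y.length = (l ++ g.tgt ++ r').length → f y = f' y) :
    ∀ x, x.length = (l ++ g.src ++ r').length → layerOp q r l g f x = layerOp q r l g f' x := by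
  induction l generalizing f f' with
  | nil =>
    intro x hx
    rcases g with ⟨o, a, b⟩ | a | a
    · rcases x with _ | ⟨i, _ | ⟨j, x⟩⟩ <;> simp [Gen.src] at hx
      simp only [layerOp, front, LinearMap.coe_mk, AddHom.coe_mk, frontFun]
      rw [h, h] <;> simp [Gen.tgt, hx]
    · simp only [layerOp, front, LinearMap.coe_mk, AddHom.coe_mk, frontFun]
      simp [Gen.src] at hx
      rw [h, h] <;> simp [Gen.tgt, hx]
    · rcases x with _ | ⟨i, _ | ⟨j, x⟩⟩ <;> simp [Gen.src] at hx
      simp only [layerOp, front, LinearMap.coe_mk, AddHom.coe_mk, frontFun]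
      rw [h] ; simp [Gen.tgt, hx]
  | cons a l ih =>
    intro x hx
    rcases x with _ | ⟨i, x⟩
    · rfl
    · refine ih (fun y => f (i :: y)) (fun y => f' (i :: y)) (fun y hy => h _ ?_) x ?_
      · simp at hy ⊢; omega
      · simp at hx ⊢; omega

theorem pull_congr (q r : A) (w : List Layer) :
    ∀ {s t : List Bool}, IsTangle s w t → ∀ f f' : List Bool → A,
      (∀ y, y.length = t.length → f y = f' y) →
      ∀ x, x.length = s.length → pull q r w f x = pull q r w f' x := by
  induction w with
  | nil => intro s t h f f' hf x hx; cases h; exact hf x hx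
  | cons L w ih =>
    intro s t h f f' hf x hx
    refine layerOp_congr q r L.gen L.left L.right _ _ (fun y hy => ?_) x ?_
    · exact ih h.2 f f' hf y hy
    · rw [hx, h.1]; rfl

theorem exchange_front (q r : A) (g : Gen) (m : List Bool) (h : Gen) (f : List Bool → A) :
    front q r g (layerOp q r (g.tgt ++ m) h f) = layerOp q r (g.src ++ m) h (front q r g f) := by
  generalize hH : layerOp q r m h = H
  have hadd : ∀ (c d : A) (f f' : List Bool → A) x,
      H (fun y => c * f y + d * f' y) x = c * H f x + d * H f' x := by
    intro c d f f' x
    have := congrFun (H.map_add (c • f) (d • f')) x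
    rw [H.map_smul, H.map_smul] at this
    exact this
  have hmul : ∀ (c : A) (f : List Bool → A) x, H (fun y => c * f y) x = c * H f x := by
    intro c f x
    exact congrFun (H.map_smul c f) x
  have hzero : ∀ x, H (fun _ => 0) x = 0 := fun x => congrFun H.map_zero x
  funext x
  rcases g with ⟨o, a, b⟩ | a | a
  · rcases x with _ | ⟨i, _ | ⟨j, x⟩⟩
    · rfl
    · rfl
    · change _ = layerOp q r m h (fun y => frontFun q r (.cross o a b) f (i :: j :: y)) x
      change frontFun q r (.cross o a b) _ (i :: j :: x) = _
      simp only [frontFun, Gen.tgt, List.cons_append, List.nil_append, layerOp, hH]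
      rw [hadd]
      rfl
  · change _ = layerOp q r m h (fun y => frontFun q r (.cup a) f y) x
    change frontFun q r (.cup a) _ x = _
    simp only [frontFun, Gen.tgt, List.cons_append, List.nil_append, layerOp, hH]
    rw [hadd]
    rfl
  · rcases x with _ | ⟨i, _ | ⟨j, x⟩⟩
    · rfl
    · rfl
    · change _ = layerOp q r m h (fun y => frontFun q r (.cap a) f (i :: j :: y)) x
      change frontFun q r (.cap a) _ (i :: j :: x) = _
      simp only [frontFun, Gen.tgt, List.nil_append, hH]
      split_ifs
      · rw [hmul]
      · rw [hzero]

theorem front_cross (q r : A) (o a b : Bool) (f : List Bool → A) (i j : Bool) (x : List Bool) :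
    front q r (.cross o a b) f (i :: j :: x) =
      swapW q r (o == (a == b)) i j * f (j :: i :: x) +
      turnW q r o a b i j * f ((bif a == b then i else !j) :: (bif a == b then j else !i) :: x) := rfl

theorem front_cup (q r : A) (a : Bool) (f : List Bool → A) (x : List Bool) :
    front q r (.cup a) f x =
      cupW r a false * f (false :: false :: x) + cupW r a true * f (true :: true :: x) := rfl

theorem front_cap (q r : A) (a : Bool) (f : List Bool → A) (i j : Bool) (x : List Bool) :
    front q r (.cap a) f (i :: j :: x) = if i = j then capW q a i * f x else 0 := rfl

theorem tail_cons (H : (List Bool → A) →ₗ[A] (List Bool → A)) (f : List Bool → A) (i : Bool)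
    (x : List Bool) : tail H f (i :: x) = H (fun y => f (i :: y)) x := rfl

set_option maxHeartbeats 4000000 in
theorem pull_slideCap (q r : A) (o a b i j k : Bool) (f : List Bool → A)
    (x : List Bool) :
    pull q r [⟨[], .cross o a b, [!a]⟩, ⟨[b], .cap a, []⟩] f (i :: j :: k :: x) =
      pull q r [⟨[a], .cross (!o) b (!a), []⟩, ⟨[], .cap a, [b]⟩] f (i :: j :: k :: x) := by
  simp only [pull, layerOp, LinearMap.comp_apply, LinearMap.id_apply, front_cross, front_cap,
    tail_cons]
  cases o <;> cases a <;> cases b <;> cases i <;> cases j <;> cases k <;>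
    simp [swapW, turnW, capW] <;> grind

set_option maxHeartbeats 4000000 in
theorem pull_slideCup (q r : A) (o a b i : Bool) (f : List Bool → A)
    (x : List Bool) :
    pull q r [⟨[b], .cup a, []⟩, ⟨[], .cross o b a, [!a]⟩] f (i :: x) =
      pull q r [⟨[], .cup a, [b]⟩, ⟨[a], .cross (!o) (!a) b, []⟩] f (i :: x) := by
  simp only [pull, layerOp, LinearMap.comp_apply, LinearMap.id_apply, front_cross, front_cup,
    tail_cons]
  cases o <;> cases a <;> cases b <;> cases i <;> simp [swapW, turnW, cupW] <;> grind

set_option maxHeartbeats 4000000 in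
theorem pull_two (q r : A) (hqr : q * r = 1) (o a b i j : Bool) (f : List Bool → A)
    (x : List Bool) :
    pull q r [⟨[], .cross o a b, []⟩, ⟨[], .cross (!o) b a, []⟩] f (i :: j :: x) =
      f (i :: j :: x) := by
  simp only [pull, layerOp, LinearMap.comp_apply, LinearMap.id_apply, front_cross]
  cases o <;> cases a <;> cases b <;> cases i <;> cases j <;> simp [swapW, turnW] <;> grind

set_option linter.unusedSimpArgs false in
set_option maxHeartbeats 4000000 in
theorem pull_three (q r : A) (hqr : q * r = 1) (o₁ o₂ o₃ a b c : Bool) (ho : o₂ = o₁ ∨ o₂ = o₃)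
    (i j k : Bool) (f : List Bool → A) (x : List Bool) :
    pull q r [⟨[], .cross o₁ a b, [c]⟩, ⟨[b], .cross o₂ a c, []⟩, ⟨[], .cross o₃ b c, [a]⟩] f
        (i :: j :: k :: x) =
      pull q r [⟨[a], .cross o₃ b c, []⟩, ⟨[], .cross o₂ a c, [b]⟩, ⟨[c], .cross o₁ a b, []⟩] f
        (i :: j :: k :: x) := by
  simp only [pull, layerOp, LinearMap.comp_apply, LinearMap.id_apply, front_cross, tail_cons]
  cases a <;> cases b <;> cases c <;> cases o₁ <;> cases o₂ <;> cases o₃ <;>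
    first
    | (exfalso; revert ho; decide)
    | (clear ho
       cases i <;> cases j <;> cases k <;>
        simp only [swapW, turnW, Bool.not_true, Bool.not_false, cond_true, cond_false,
          beq_self_eq_true, Bool.true_beq, Bool.false_beq, zero_mul, one_mul, mul_zero, zero_add,
          add_zero, reduceCtorEq, mul_one] <;> grind)

/-- All local moves preserve the action. -/
theorem pull_move (q r : A) (hqr : q * r = 1) {w w' : List Layer} (hm : Move w w') :
    ∀ {s t : List Bool}, IsTangle s w t → ∀ (f : List Bool → A) (x : List Bool),
      s.length ≤ x.length → pull q r w f x = pull q r w' f x := by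
  intro s t hw f x hx
  cases hm with
  | exchange l m r' g h =>
    clear hw hx s t
    simp only [pull, LinearMap.comp_apply, LinearMap.id_apply]
    induction l generalizing f x with
    | nil => exact congrFun (exchange_front q r g m h f) x
    | cons a l ih =>
      rcases x with _ | ⟨i, x⟩
      · rfl
      · exact ih (fun y => f (i :: y)) x
  | zigzagRight a =>
    rw [hw.1] at hx
    rcases x with _ | ⟨i, x⟩
    · simp [Layer.src] at hx
    · simp only [pull, layerOp, LinearMap.comp_apply, LinearMap.id_apply, front_cup, front_cap,
        tail_cons]
      cases a <;> cases i <;> simp [cupW, capW] <;> grind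
  | zigzagLeft a =>
    rw [hw.1] at hx
    rcases x with _ | ⟨i, x⟩
    · simp [Layer.src, Gen.src] at hx
    · simp only [pull, layerOp, LinearMap.comp_apply, LinearMap.id_apply, front_cup, front_cap,
        tail_cons]
      cases a <;> cases i <;> simp [cupW, capW] <;> grind
  | slideCap o a b =>
    rw [hw.1] at hx
    rcases x with _ | ⟨i, _ | ⟨j, _ | ⟨k, x⟩⟩⟩
    · simp [Layer.src, Gen.src] at hx
    · simp [Layer.src, Gen.src] at hx
    · simp [Layer.src, Gen.src] at hx
    · exact pull_slideCap q r o a b i j k f x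
  | slideCup o a b =>
    rw [hw.1] at hx
    rcases x with _ | ⟨i, x⟩
    · simp [Layer.src] at hx
    · exact pull_slideCup q r o a b i f x
  | reidemeisterOneCup o a =>
    simp only [pull, layerOp, LinearMap.comp_apply, LinearMap.id_apply, front_cup, front_cross]
    cases o <;> cases a <;> simp [swapW, turnW, cupW] <;> grind
  | reidemeisterOneCap o a =>
    rw [hw.1] at hx
    rcases x with _ | ⟨i, _ | ⟨j, x⟩⟩
    · simp [Layer.src, Gen.src] at hx
    · simp [Layer.src, Gen.src] at hx
    · simp only [pull, layerOp, LinearMap.comp_apply, LinearMap.id_apply, front_cap, front_cross]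
      cases o <;> cases a <;> cases i <;> cases j <;> simp [swapW, turnW, capW] <;> grind
  | reidemeisterTwo o a b =>
    rw [hw.1] at hx
    rcases x with _ | ⟨i, _ | ⟨j, x⟩⟩
    · simp [Layer.src, Gen.src] at hx
    · simp [Layer.src, Gen.src] at hx
    · exact pull_two q r hqr o a b i j f x
  | reidemeisterThree o₁ o₂ o₃ a b c ho =>
    rw [hw.1] at hx
    rcases x with _ | ⟨i, _ | ⟨j, _ | ⟨k, x⟩⟩⟩
    · simp [Layer.src, Gen.src] at hx
    · simp [Layer.src, Gen.src] at hx
    · simp [Layer.src, Gen.src] at hx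
    · exact pull_three q r hqr o₁ o₂ o₃ a b c ho i j k f x

/-- The two odd symmetries (`e = true`, `e = false`) of the action. -/
def hitW (q : A) : Bool → Bool → Bool → A
  | true, true, false => 1
  | true, false, true => -q
  | false, true, true => 1
  | false, false, false => q
  | _, _, _ => 0

def strW (q r : A) : Bool → Bool → A
  | true, false => r
  | true, true => -r
  | false, false => q
  | false, true => -q

def odd (q r : A) (e : Bool) : List Bool → (List Bool → A) → List Bool → A
  | a :: s, f, i :: x =>
      hitW q e a i * f ((!i) :: x) + strW q r a i * odd q r e s (fun y => f (i :: y)) x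
  | _ :: _, _, [] => 0
  | [], _, _ => 0

theorem odd_lin (q r : A) (e : Bool) (s : List Bool) : ∀ (c d : A) (f f' : List Bool → A) x,
    odd q r e s (fun y => c * f y + d * f' y) x = c * odd q r e s f x + d * odd q r e s f' x := by
  induction s with
  | nil => intro c d f f' x; simp [odd]
  | cons a s ih =>
    intro c d f f' x
    rcases x with _ | ⟨i, x⟩
    · simp [odd]
    · simp only [odd, ih]; ring

theorem odd_smul (q r : A) (e : Bool) (s : List Bool) (c : A) (f : List Bool → A) (x : List Bool) :
    odd q r e s (fun y => c * f y) x = c * odd q r e s f x := by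
  have := odd_lin q r e s c 0 f f x
  simpa using this

theorem odd_zero (q r : A) (e : Bool) (s : List Bool) (x : List Bool) :
    odd q r e s (fun _ => 0) x = 0 := by
  have := odd_smul q r e s 0 (fun _ => 0) x
  simpa using this

theorem odd_front (q r : A) (hqr : q * r = 1) (e : Bool) (g : Gen) (s : List Bool)
    (f : List Bool → A) (x : List Bool) (hx : x.length = (g.src ++ s).length) :
    odd q r e (g.src ++ s) (front q r g f) x = front q r g (odd q r e (g.tgt ++ s) f) x := by
  rcases g with ⟨o, a, b⟩ | a | a
  · rcases x with _ | ⟨i, _ | ⟨j, x⟩⟩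
    · simp [Gen.src] at hx
    · simp [Gen.src] at hx
    · simp only [Gen.src, Gen.tgt, List.cons_append, List.nil_append, odd, front_cross, odd_lin]
      cases e <;> cases o <;> cases a <;> cases b <;> cases i <;> cases j <;>
        simp only [hitW, strW, swapW, turnW, Bool.not_true, Bool.not_false, cond_true, cond_false,
          beq_self_eq_true, Bool.true_beq, Bool.false_beq] <;> grind
  · simp only [Gen.src, Gen.tgt, List.cons_append, List.nil_append, odd, front_cup]
    have : odd q r e s (front q r (.cup a) f) x =
        cupW r a false * odd q r e s (fun y => f (false :: false :: y)) x +
          cupW r a true * odd q r e s (fun y => f (true :: true :: y)) x :=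
      odd_lin q r e s _ _ _ _ x
    rw [this]
    cases e <;> cases a <;> simp only [hitW, strW, cupW, Bool.not_true, Bool.not_false] <;> grind
  · rcases x with _ | ⟨i, _ | ⟨j, x⟩⟩
    · simp [Gen.src] at hx
    · simp [Gen.src] at hx
    · simp only [Gen.src, Gen.tgt, List.cons_append, List.nil_append, odd, front_cap]
      cases e <;> cases a <;> cases i <;> cases j <;>
        simp only [hitW, strW, capW, Bool.not_true, Bool.not_false, if_true, if_false, odd_smul,
          odd_zero, reduceCtorEq] <;> grind

theorem odd_layerOp (q r : A) (hqr : q * r = 1) (e : Bool) (g : Gen) (s l : List Bool) :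
    ∀ (f : List Bool → A) (x : List Bool), x.length = (l ++ (g.src ++ s)).length →
      odd q r e (l ++ (g.src ++ s)) (layerOp q r l g f) x =
        layerOp q r l g (odd q r e (l ++ (g.tgt ++ s)) f) x := by
  induction l with
  | nil => intro f x hx; exact odd_front q r hqr e g s f x hx
  | cons a l ih =>
    intro f x hx
    rcases x with _ | ⟨i, x⟩
    · simp at hx
    · have hx' : x.length = (l ++ (g.src ++ s)).length := by simpa using hx
      have h1 := ih (fun y => f (i :: y)) x hx'
      change hitW q e a i * layerOp q r l g (fun y => f ((!i) :: y)) x +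
        strW q r a i * odd q r e (l ++ (g.src ++ s)) (layerOp q r l g (fun y => f (i :: y))) x =
        layerOp q r l g (hitW q e a i • (fun y => f ((!i) :: y)) +
          strW q r a i • odd q r e (l ++ (g.tgt ++ s)) (fun y => f (i :: y))) x
      rw [h1, map_add, map_smul, map_smul]
      rfl

theorem odd_pull (q r : A) (hqr : q * r = 1) (e : Bool) (f : List Bool → A) (w : List Layer) :
    ∀ {s t : List Bool}, IsTangle s w t → ∀ x, x.length = s.length →
      odd q r e s (pull q r w f) x = pull q r w (odd q r e t f) x := by
  induction w with
  | nil => intro s t h x hx; cases h; rfl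
  | cons L w ih =>
    intro s t h x hx
    obtain ⟨rfl, h2⟩ := h
    have hx' : x.length = (L.left ++ (L.gen.src ++ L.right)).length := by
      simpa [Layer.src] using hx
    have h1 := odd_layerOp q r hqr e L.gen L.right L.left (pull q r w f) x hx'
    have h3 : L.src = L.left ++ (L.gen.src ++ L.right) := by simp [Layer.src]
    have h4 : L.tgt = L.left ++ (L.gen.tgt ++ L.right) := by simp [Layer.tgt]
    rw [h3]
    refine h1.trans (layerOp_congr q r L.gen L.left L.right _ _ (fun y hy => ?_) x ?_)
    · rw [← h4]; exact ih h2 y hy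
    · simpa using hx'

theorem odd_closed (q r : A) (hqr : q * r = 1) (e : Bool) (w : List Layer) {s : List Bool}
    (h : IsTangle s w []) (x : List Bool) (hx : x.length = s.length) :
    odd q r e s (pull q r w (fun _ => 1)) x = 0 := by
  rw [odd_pull q r hqr e _ w h x hx]
  exact congrFun (map_zero (pull q r w)) x

/-- The value of a link diagram: the first layer is a minimum, at which the diagram is cut. -/
def cutValue (q r : A) : List Layer → A
  | ⟨_, .cup a, _⟩ :: w => (bif a then 1 else r) * pull q r w (fun _ => 1) [false, false]
  | _ => 0

theorem first_layer {L : Layer} {w : List Layer} {t : List Bool} (h : IsTangle [] (L :: w) t) :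
    ∃ a, L = ⟨[], .cup a, []⟩ := by
  obtain ⟨l, g, r⟩ := L
  have h1 := h.1
  simp only [Layer.src, List.nil_eq_append_iff, List.append_eq_nil_iff] at h1
  obtain ⟨⟨rfl, hg⟩, rfl⟩ := h1
  rcases g with ⟨o, a, b⟩ | a | a
  · simp [Gen.src] at hg
  · exact ⟨a, rfl⟩
  · simp [Gen.src] at hg

theorem cutValue_cong (q r : A) {L : Layer} {u w w' : List Layer} {t : List Bool}
    (h : IsTangle [] (L :: u) t)
    (hw : ∀ y, y.length = t.length →
      pull q r w (fun _ => 1) y = pull q r w' (fun _ => 1) y) :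
    cutValue q r (L :: u ++ w) = cutValue q r (L :: u ++ w') := by
  obtain ⟨a, rfl⟩ := first_layer h
  simp only [List.cons_append, cutValue]
  rw [pull_append, pull_append]
  exact congrArg _ (pull_congr q r u h.2 _ _ hw [false, false] rfl)

theorem pull_shift_congr (q r : A) {w w' : List Layer} (n : ℕ)
    (hw : ∀ f x, n ≤ x.length → pull q r w f x = pull q r w' f x) (l r' : List Bool) :
    ∀ f x, l.length + n ≤ x.length →
      pull q r (w.map (Layer.shift l r')) f x = pull q r (w'.map (Layer.shift l r')) f x := by
  induction l with
  | nil =>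
    intro f x hx
    rw [pull_shift_nil, pull_shift_nil]
    exact hw f x (by simpa using hx)
  | cons a l ih =>
    intro f x hx
    rcases x with _ | ⟨i, x⟩
    · simp at hx
    · rw [pull_shift_cons, pull_shift_cons]
      exact ih _ x (by simp at hx; omega)

theorem cutValue_exchange (q r : A) (hqr : q * r = 1) (a b : Bool) (w : List Layer)
    (h : IsTangle [a, !a, b, !b] w []) :
    cutValue q r (⟨[], .cup a, []⟩ :: ⟨[a, !a], .cup b, []⟩ :: w) =
      cutValue q r (⟨[], .cup b, []⟩ :: ⟨[], .cup a, [b, !b]⟩ :: w) := by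
  have hE := odd_closed q r hqr true w h
  have hF := odd_closed q r hqr false w h
  generalize hp : pull q r w (fun _ => 1) = p at hE hF
  simp only [cutValue, pull, LinearMap.comp_apply, layerOp, tail_cons, front_cup, hp]
  have e1 := hE [false, false, false, true] rfl
  have e2 := hE [false, false, true, false] rfl
  have e3 := hE [false, true, false, false] rfl
  have e4 := hE [true, false, false, false] rfl
  have f1 := hF [false, false, false, true] rfl
  have f2 := hF [false, false, true, false] rfl
  have f3 := hF [false, true, false, false] rfl
  have f4 := hF [true, false, false, false] rfl
  clear hE hF hp
  cases a <;> cases b <;>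
    simp only [odd, hitW, strW, cupW, Bool.not_true, Bool.not_false, cond_true, cond_false,
      zero_mul, mul_zero, add_zero, zero_add, one_mul] at e1 e2 e3 e4 f1 f2 f3 f4 ⊢ <;> grind

theorem cutValue_one (q r : A) (hqr : q * r = 1) (o a : Bool) (w : List Layer)
    (h : IsTangle [!a, a] w []) :
    cutValue q r (⟨[], .cup a, []⟩ :: ⟨[], .cross o a (!a), []⟩ :: w) =
      cutValue q r (⟨[], .cup (!a), []⟩ :: w) := by
  have hE := odd_closed q r hqr true w h
  have hF := odd_closed q r hqr false w h
  generalize hp : pull q r w (fun _ => 1) = p at hE hF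
  simp only [cutValue, pull, LinearMap.comp_apply, layerOp, front_cross, hp]
  have e1 := hE [false, true] rfl
  have e2 := hE [true, false] rfl
  have f1 := hF [false, true] rfl
  have f2 := hF [true, false] rfl
  clear hE hF hp
  cases a <;> cases o <;>
    simp only [odd, hitW, strW, swapW, turnW, Bool.not_true, Bool.not_false, cond_true, cond_false,
      zero_mul, mul_zero, add_zero, zero_add, one_mul, beq_self_eq_true, Bool.true_beq,
      Bool.false_beq] at e1 e2 f1 f2 ⊢ <;> grind

theorem cutValue_move (q r : A) (hqr : q * r = 1) {w w' u : List Layer} (hm : Move w w')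
    {t : List Bool} (hw : IsTangle [] w t) (hu : IsTangle t u []) :
    cutValue q r (w ++ u) = cutValue q r (w' ++ u) := by
  cases hm with
  | exchange l m r' g h =>
    have h1 := hw.1
    simp only [Layer.src, List.nil_eq_append_iff, List.append_eq_nil_iff] at h1
    obtain ⟨⟨rfl, hg⟩, ⟨rfl, hh⟩, rfl⟩ := h1
    rcases g with ⟨o, a, b⟩ | a | a
    · simp [Gen.src] at hg
    · rcases h with ⟨o, c, d⟩ | b | b
      · simp [Gen.src] at hh
      · obtain ⟨-, -, rfl⟩ := hw
        exact cutValue_exchange q r hqr a b u hu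
      · simp [Gen.src] at hh
    · simp [Gen.src] at hg
  | zigzagRight a => exact absurd hw.1 (by simp [Layer.src])
  | zigzagLeft a => exact absurd hw.1 (by simp [Layer.src])
  | slideCap o a b => exact absurd hw.1 (by simp [Layer.src])
  | slideCup o a b => exact absurd hw.1 (by simp [Layer.src])
  | reidemeisterOneCup o a =>
    obtain ⟨-, -, rfl⟩ := hw
    exact cutValue_one q r hqr o a u hu
  | reidemeisterOneCap o a => exact absurd hw.1 (by simp [Layer.src, Gen.src])
  | reidemeisterTwo o a b => exact absurd hw.1 (by simp [Layer.src, Gen.src])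
  | reidemeisterThree o₁ o₂ o₃ a b c ho => exact absurd hw.1 (by simp [Layer.src])

theorem cutValue_step (q r : A) (hqr : q * r = 1) {D D' : LinkDiagram} (h : Step D D') :
    cutValue q r D.1 = cutValue q r D'.1 := by
  obtain ⟨⟨l, r', ⟨B, hB⟩, ⟨C, hC⟩⟩, ⟨w, hw⟩, ⟨w', hw'⟩, hm⟩ := h
  rename_i s t
  change cutValue q r (B ++ (w.map (Layer.shift l r') ++ C)) =
    cutValue q r (B ++ (w'.map (Layer.shift l r') ++ C))
  rcases B with _ | ⟨L, B⟩
  · have h1 : [] = l ++ s ++ r' := hB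
    simp only [List.nil_eq_append_iff, List.append_eq_nil_iff] at h1
    obtain ⟨⟨rfl, rfl⟩, rfl⟩ := h1
    have hid : ∀ v : List Layer, v.map (Layer.shift [] []) = v := by
      intro v
      induction v with
      | nil => rfl
      | cons L v ih => simp [ih, Layer.shift]
    rw [hid, hid]
    exact cutValue_move q r hqr hm hw (by simpa using hC)
  · refine cutValue_cong q r hB (fun y hy => ?_)
    rw [pull_append, pull_append]
    exact pull_shift_congr q r s.length (fun f x hx => pull_move q r hqr hm hw f x hx) l r' _ y
      (by simp at hy; omega)

theorem cutValue_skein (q r : A) (O : Outside [true, true] [true, true]) :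
    cutValue q r (O.fill (upCrossing true)).1 - cutValue q r (O.fill (upCrossing false)).1 =
      (q - r) * cutValue q r (O.fill (vertical true true)).1 := by
  obtain ⟨l, r', ⟨B, hB⟩, ⟨C, hC⟩⟩ := O
  rcases B with _ | ⟨L, B⟩
  · exact absurd hB (by simp [IsTangle])
  · obtain ⟨a, rfl⟩ := first_layer hB
    simp only [Outside.fill, upCrossing, vertical, List.cons_append, cutValue, pull_append]
    generalize pull q r C (fun _ => 1) = c
    have key : ∀ (l : List Bool) (c : List Bool → A) (y : List Bool),
        y.length = (l ++ [true, true] ++ r').length →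
        pull q r ([⟨[], .cross true true true, []⟩].map (Layer.shift l r')) c y =
          (pull q r ([⟨[], .cross false true true, []⟩].map (Layer.shift l r')) c +
            (q - r) • pull q r (List.map (Layer.shift l r') []) c) y := by
      intro l
      induction l with
      | nil =>
        intro c y hy
        rcases y with _ | ⟨i, _ | ⟨j, y⟩⟩
        · simp at hy
        · simp at hy
        · simp only [List.map_cons, List.map_nil, Layer.shift, List.nil_append, pull, layerOp,
            LinearMap.comp_apply, LinearMap.id_apply, Pi.add_apply, Pi.smul_apply, smul_eq_mul,
            front_cross]
          cases i <;> cases j <;> simp [swapW, turnW] <;> ring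
      | cons a l ih =>
        intro c y hy
        rcases y with _ | ⟨i, y⟩
        · simp at hy
        · exact ih (fun z => c (i :: z)) y (by simpa using hy)
    rw [pull_congr q r B hB.2 _ _ (key l c) [false, false] rfl, map_add, map_smul]
    simp only [Pi.add_apply, Pi.smul_apply, smul_eq_mul]
    ring

end Existence

theorem exists_isConway : ∃ N : LinkDiagram → ℤ[X], IsConway N := by
  let A := QuadraticAlgebra ℤ[X] 1 X
  let q : A := ⟨0, 1⟩
  let r : A := ⟨-X, 1⟩
  have hqr : q * r = 1 := by
    apply QuadraticAlgebra.ext <;>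
      simp [q, r, A, QuadraticAlgebra.re_one, QuadraticAlgebra.im_one]
  have hz : q - r = ⟨X, 0⟩ := by
    apply QuadraticAlgebra.ext <;> simp [q, r, A]
  refine ⟨fun D => (cutValue q r D.1).re, ⟨fun D D' h => ?_, ?_, fun O => ?_⟩⟩
  · have h' : cutValue q r D.1 = cutValue q r D'.1 := by
      induction h with
      | rel D D' h => exact cutValue_step q r hqr h
      | refl D => rfl
      | symm D D' _ ih => exact ih.symm
      | trans D D' D'' _ _ ih ih' => exact ih.trans ih'
    exact congrArg QuadraticAlgebra.re h'
  · simp [circle, cutValue, pull, layerOp, front_cap, capW, A, QuadraticAlgebra.re_one]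
  · have h := congrArg QuadraticAlgebra.re (cutValue_skein q r O)
    rw [hz] at h
    simpa [A] using h

/-- The Conway polynomial. -/
noncomputable def conway : LinkDiagram → ℤ[X] := Classical.choose exists_isConway

theorem conway_isConway : IsConway conway := Classical.choose_spec exists_isConway

/-! ### Twisted strands, tangle sums and torus links -/

/-- The layers of `n` half-twists, all crossings of the same kind, starting from strands of
directions `a` and `b`. -/
def twistLayers (o : Bool) : ℕ → Bool → Bool → List Layer
  | 0, _, _ => []
  | n + 1, a, b => ⟨[], .cross o a b, []⟩ :: twistLayers o n b a

theorem twistLayers_isTangle (o : Bool) (n : ℕ) : ∀ a b : Bool,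
    IsTangle [a, b] (twistLayers o n a b) (if Even n then [a, b] else [b, a]) := by
  induction n with
  | zero => intro a b; rfl
  | succ n ih =>
    intro a b
    refine ⟨rfl, ?_⟩
    have h := ih b a
    by_cases hn : Even n <;> simpa [hn, Nat.even_add_one, Layer.tgt, Gen.tgt] using h

/-- A pair of vertical strands with `k` half-twists, `k` even: right-handed if `k > 0`,
left-handed if `k < 0`. The directions at the bottom and at the top are `a` and `b`. -/
def evenTwist (k : ℤ) (hk : Even k) (a b : Bool) : Tangle [a, b] [a, b] :=
  ⟨twistLayers (decide (0 < k)) k.natAbs a b, by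
    have h := twistLayers_isTangle (decide (0 < k)) k.natAbs a b
    rwa [if_pos (Int.natAbs_even.mpr hk)] at h⟩

/-- A pair of vertical strands with `k` half-twists, `k` odd: right-handed if `k > 0`,
left-handed if `k < 0`. The directions are `a`, `b` at the bottom and `b`, `a` at the top. -/
def oddTwist (k : ℤ) (hk : Odd k) (a b : Bool) : Tangle [a, b] [b, a] :=
  ⟨twistLayers (decide (0 < k)) k.natAbs a b, by
    have h := twistLayers_isTangle (decide (0 < k)) k.natAbs a b
    rwa [if_neg (Nat.not_even_iff_odd.mpr (Int.natAbs_odd.mpr hk))] at h⟩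

/-- The tangle `∞` with antiparallel horizontal arcs: the arc joining the bottom ends and the arc
joining the top ends have opposite directions. -/
def inftyAnti (a : Bool) : Tangle [a, !a] [a, !a] :=
  ⟨[⟨[], .cap a, []⟩, ⟨[], .cup a, []⟩], rfl, rfl, rfl⟩

/-- The tangle `∞` with parallel horizontal arcs: the arc joining the bottom ends and the arc
joining the top ends have the same direction. -/
def inftyPar (a : Bool) : Tangle [a, !a] [!a, a] :=
  ⟨[⟨[], .cap a, []⟩, ⟨[], .cup (!a), []⟩], rfl, rfl, by simp [IsTangle, Layer.tgt, Gen.tgt]⟩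

/-- The sum of two tangle diagrams: the right top (resp. bottom) end of the first is joined to the
left top (resp. bottom) end of the second. -/
def tangleSum {a b a' b' c d c' d' : Bool} (T : Tangle [a, b] [a', b'])
    (T' : Tangle [c, d] [c', d']) (hbot : c = !b) (htop : c' = !b') : Tangle [a, d] [a', d'] :=
  ⟨⟨[a], .cup b, [d]⟩ :: (T.1.map (Layer.shift [] [c, d]) ++
      (T'.1.map (Layer.shift [a', b'] []) ++ [⟨[a'], .cap b', [d']⟩])), by
    subst hbot htop
    refine ⟨rfl, (T.2.shift [] [!b, d]).append ((T'.2.shift [a', b'] []).append ⟨rfl, rfl⟩)⟩⟩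

/-- The closure of a tangle diagram: its left top and left bottom ends are joined by a simple arc,
and so are its right top and right bottom ends. -/
def closure {a b : Bool} (T : Tangle [a, b] [a, b]) : LinkDiagram :=
  ⟨⟨[], .cup (!a), []⟩ :: ⟨[!a, a], .cup b, []⟩ ::
      (T.1.map (Layer.shift [!a] [!b]) ++ [⟨[!a, a], .cap b, []⟩, ⟨[], .cap (!a), []⟩]), by
    refine ⟨rfl, by simp [Layer.tgt, Layer.src, Gen.tgt, Gen.src], ?_⟩
    exact (T.2.shift [!a] [!b]).append ⟨rfl, by simp [Layer.tgt, Layer.src, Gen.tgt, Gen.src], rfl⟩⟩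

/-! ### The polynomials `Φ(p, z)` and `Ψ(p, z)` -/

/-- `Φ(p, z) = ∑ i, (p + i choose 2 i + 1) z ^ (2 i + 1)`; the terms with `i ≥ |p|` vanish. -/
noncomputable def Phi (p : ℤ) : ℤ[X] :=
  ∑ i ∈ Finset.range p.natAbs, C (Ring.choose (p + i) (2 * i + 1)) * X ^ (2 * i + 1)

/-- `Ψ(p, z) = ∑ i, (p + i choose 2 i) z ^ (2 i)`; the terms with `i > |p|` vanish. -/
noncomputable def Psi (p : ℤ) : ℤ[X] :=
  ∑ i ∈ Finset.range (p.natAbs + 1), C (Ring.choose (p + i) (2 * i)) * X ^ (2 * i)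

end LinkDiag

/-!
The proof uses only that `conway` satisfies the Conway axioms, and it is a computation in the skein
module of a disc. `IsotopicIn` records isotopies of tangle diagrams inside a disc and `SkeinIn`
records linear relations `∇ w = ∇ w' + c * ∇ w''` between them; both may be used inside any larger
tangle diagram (`IsotopicIn.context`, `SkeinIn.context`). Turning a crossing by right angles
(`isotopicIn_rotate`) carries the skein relation from upward strands to all orientations.

*Antiparallel strands.* Changing one of `k + 1` half-twists cancels it with a neighbour, and
smoothing it turns the others into curls, so each pair of half-twists adds `-z` times the tangle `∞`
(`skeinIn_evenTwist_antiparallel`, `skeinIn_oddTwist_antiparallel`). The sum of a `k`-twist and a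
`-k`-twist is expanded in both summands: `∞` is a unit for the sum, two untwisted summands contain a
split circle, and opposite crossings next to each other cancel to `∞`.

*Parallel strands.* The twists `T k` satisfy `T (k + 1) = T (k - 1) + z * T k`
(`skeinIn_intTwist_parallel`), a recurrence whose fundamental solution takes the value `Φ(p, z)` at
`2 * p` and `Ψ(p, z)` at `2 * p + 1` (`eq_Phi_Psi_of_recurrence`), by Pascal's rule. This gives the
torus links at once. The sum of `T j` and `T k` satisfies the recurrence in both variables; it
vanishes for `j = k = 0` (split circle), is a pair of vertical strands for `(1, 0)` and
`(0, 1)` (a curl), and is `∞` for `(1, -1)`. For `k = -j` the contributions of the vertical strands cancel, because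
`Φ(-p, z) = -Φ(p, z)` and `Ψ(-p - 1, z) = Ψ(p, z)`.
-/

namespace LinkDiag

attribute [local simp] IsTangle Layer.src Layer.tgt Gen.src Gen.tgt Layer.shift

/-! ### Isotopies and skein relations inside a disc -/

@[simp]
theorem Layer.shift_nil_nil : Layer.shift [] [] = id := by
  funext L
  simp

/-- Seen from a tangle diagram inside a larger tangle diagram `u ++ _ ++ v`, the outside consists
of the outside of the larger one together with `u` and `v`. -/
def Outside.inner {x y s t l r : List Bool} {u v : List Layer} (O : Outside x y)
    (hu : IsTangle x u (l ++ s ++ r)) (hv : IsTangle (l ++ t ++ r) v y) : Outside s t where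
  left := O.left ++ l
  right := r ++ O.right
  below := ⟨O.below.1 ++ u.map (Layer.shift O.left O.right), by
    simpa using O.below.2.append (hu.shift O.left O.right)⟩
  above := ⟨v.map (Layer.shift O.left O.right) ++ O.above.1, by
    simpa using (hv.shift O.left O.right).append O.above.2⟩

theorem isTangle_context {x y s t l r : List Bool} {u v w : List Layer}
    (hu : IsTangle x u (l ++ s ++ r)) (hv : IsTangle (l ++ t ++ r) v y) (h : IsTangle s w t) :
    IsTangle x (u ++ (w.map (Layer.shift l r) ++ v)) y :=
  hu.append ((h.shift l r).append hv)

theorem Outside.inner_fill {x y s t l r : List Bool} {u v w : List Layer} (O : Outside x y)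
    (hu : IsTangle x u (l ++ s ++ r)) (hv : IsTangle (l ++ t ++ r) v y) (h : IsTangle s w t) :
    (O.inner hu hv).fill ⟨w, h⟩ = O.fill ⟨_, isTangle_context hu hv h⟩ := by
  apply Subtype.ext
  simp [Outside.fill, Outside.inner, Function.comp_def]

/-- The words `w` and `w'` are tangle diagrams with bottom ends `s` and top ends `t`, and replacing
one by the other inside a disc does not change the isotopy class of a link diagram. -/
def IsotopicIn (s t : List Bool) (w w' : List Layer) : Prop :=
  ∃ (h : IsTangle s w t) (h' : IsTangle s w' t),
    ∀ O : Outside s t, Isotopic (O.fill ⟨w, h⟩) (O.fill ⟨w', h'⟩)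

namespace IsotopicIn

variable {s t x y l r : List Bool} {w w' w'' : List Layer}

theorem refl (h : IsTangle s w t) : IsotopicIn s t w w := ⟨h, h, fun _ => .refl _⟩

theorem symm : IsotopicIn s t w w' → IsotopicIn s t w' w
  | ⟨h, h', H⟩ => ⟨h', h, fun O => .symm _ _ (H O)⟩

theorem trans : IsotopicIn s t w w' → IsotopicIn s t w' w'' → IsotopicIn s t w w''
  | ⟨h, _, H⟩, ⟨_, h'', H'⟩ => ⟨h, h'', fun O => .trans _ _ _ (H O) (H' O)⟩

theorem of_move (m : Move w w') (h : IsTangle s w t := by simp) (h' : IsTangle s w' t := by simp) :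
    IsotopicIn s t w w' := ⟨h, h', fun O => .rel _ _ (.mk O ⟨w, h⟩ ⟨w', h'⟩ m)⟩

/-- An isotopy inside a disc is an isotopy inside any larger disc. -/
theorem context (H : IsotopicIn s t w w') (u : List Layer) (l r : List Bool) (v : List Layer)
    (hu : IsTangle x u (l ++ s ++ r) := by simp) (hv : IsTangle (l ++ t ++ r) v y := by simp) :
    IsotopicIn x y (u ++ (w.map (Layer.shift l r) ++ v))
      (u ++ (w'.map (Layer.shift l r) ++ v)) := by
  obtain ⟨h, h', H⟩ := H
  refine ⟨isTangle_context hu hv h, isTangle_context hu hv h', fun O => ?_⟩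
  have := H (O.inner hu hv)
  rwa [O.inner_fill, O.inner_fill] at this

theorem conway_eq (H : IsotopicIn s t w w') (h : IsTangle s w t) (h' : IsTangle s w' t)
    (O : Outside s t) : conway (O.fill ⟨w, h⟩) = conway (O.fill ⟨w', h'⟩) :=
  conway_isConway.isotopy _ _ (H.choose_spec.choose_spec O)

end IsotopicIn

/-- The words `w`, `w'`, `w''` are tangle diagrams with bottom ends `s` and top ends `t`, and
`∇ w = ∇ w' + c * ∇ w''` whenever they are placed in the same disc of a link diagram. -/
def SkeinIn (s t : List Bool) (w w' : List Layer) (c : ℤ[X]) (w'' : List Layer) : Prop :=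
  ∃ (h : IsTangle s w t) (h' : IsTangle s w' t) (h'' : IsTangle s w'' t),
    ∀ O : Outside s t,
      conway (O.fill ⟨w, h⟩) = conway (O.fill ⟨w', h'⟩) + c * conway (O.fill ⟨w'', h''⟩)

namespace SkeinIn

variable {s t x y : List Bool} {w w' w'' v v' v'' : List Layer} {c d : ℤ[X]}

theorem symm (H : SkeinIn s t w w' c w'') : SkeinIn s t w' w (-c) w'' := by
  obtain ⟨h, h', h'', H⟩ := H
  exact ⟨h', h, h'', fun O => by rw [H O]; ring⟩

theorem trans (H : SkeinIn s t w w' c w'') (H' : SkeinIn s t w' v d w'') :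
    SkeinIn s t w v (c + d) w'' := by
  obtain ⟨h, h', h'', H⟩ := H
  obtain ⟨_, k', _, H'⟩ := H'
  exact ⟨h, k', h'', fun O => by rw [H O, H' O]; ring⟩

theorem conway_eq (H : SkeinIn s t w w' c w'') (h : IsTangle s w t) (h' : IsTangle s w' t)
    (h'' : IsTangle s w'' t) (O : Outside s t) :
    conway (O.fill ⟨w, h⟩) = conway (O.fill ⟨w', h'⟩) + c * conway (O.fill ⟨w'', h''⟩) :=
  H.choose_spec.choose_spec.choose_spec O

theorem congr (H : SkeinIn s t w w' c w'') (e : IsotopicIn s t w v) (e' : IsotopicIn s t w' v')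
    (e'' : IsotopicIn s t w'' v'') : SkeinIn s t v v' c v'' := by
  obtain ⟨h, h', h'', H⟩ := H
  obtain ⟨-, k, -⟩ := id e
  obtain ⟨-, k', -⟩ := id e'
  obtain ⟨-, k'', -⟩ := id e''
  refine ⟨k, k', k'', fun O => ?_⟩
  rw [← e.conway_eq h k, ← e'.conway_eq h' k', ← e''.conway_eq h'' k'', H O]

/-- A skein relation inside a disc holds inside any larger disc. -/
theorem context (H : SkeinIn s t w w' c w'') (u : List Layer) (l r : List Bool) (v : List Layer)
    (hu : IsTangle x u (l ++ s ++ r) := by simp) (hv : IsTangle (l ++ t ++ r) v y := by simp) :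
    SkeinIn x y (u ++ (w.map (Layer.shift l r) ++ v)) (u ++ (w'.map (Layer.shift l r) ++ v)) c
      (u ++ (w''.map (Layer.shift l r) ++ v)) := by
  obtain ⟨h, h', h'', H⟩ := H
  refine ⟨isTangle_context hu hv h, isTangle_context hu hv h', isTangle_context hu hv h'',
    fun O => ?_⟩
  have := H (O.inner hu hv)
  rwa [O.inner_fill, O.inner_fill, O.inner_fill] at this

/-- A relation between consecutive terms of a two-sided sequence, with constant difference `c * w`,
is summed up. -/
theorem iterate {f : ℤ → List Layer} (H : ∀ p, SkeinIn s t (f (p + 1)) (f p) c w) (p : ℤ) :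
    SkeinIn s t (f p) (f 0) (C p * c) w := by
  induction p with
  | zero =>
    obtain ⟨-, h', h'', -⟩ := H 0
    exact ⟨h', h', h'', fun O => by simp⟩
  | succ n ih => simpa [add_mul, add_comm] using (H n).trans ih
  | pred n ih =>
    have := H (-n - 1)
    rw [sub_add_cancel] at this
    have := this.symm.trans ih
    have e : -c + C (-(n : ℤ)) * c = C (-(n : ℤ) - 1) * c := by
      rw [C_sub, C_1]; ring
    rwa [e] at this

end SkeinIn

/-! ### Isotopies of small tangles -/

open IsotopicIn

/-- A crossing turned by a right angle is a crossing: after sliding it through the maximum, the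
minimum cancels the maximum. -/
theorem isotopicIn_rotate (o a b : Bool) :
    IsotopicIn [b, !a] [!a, b]
      [⟨[], .cup (!a), [b, !a]⟩, ⟨[!a], .cross o a b, [!a]⟩, ⟨[!a, b], .cap a, []⟩]
      [⟨[], .cross (!o) b (!a), []⟩] := by
  have h1 : IsotopicIn [b, !a] [!a, b]
      [⟨[], .cup (!a), [b, !a]⟩, ⟨[!a], .cross o a b, [!a]⟩, ⟨[!a, b], .cap a, []⟩]
      [⟨[], .cup (!a), [b, !a]⟩, ⟨[!a, a], .cross (!o) b (!a), []⟩, ⟨[!a], .cap a, [b]⟩] := by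
    simpa using (of_move (.slideCap o a b) (s := [a, b, !a]) (t := [b])).context
      (x := [b, !a]) (y := [!a, b]) [⟨[], .cup (!a), [b, !a]⟩] [!a] [] []
  have h2 : IsotopicIn [b, !a] [!a, b]
      [⟨[], .cup (!a), [b, !a]⟩, ⟨[!a, a], .cross (!o) b (!a), []⟩, ⟨[!a], .cap a, [b]⟩]
      [⟨[], .cross (!o) b (!a), []⟩, ⟨[], .cup (!a), [!a, b]⟩, ⟨[!a], .cap a, [b]⟩] := by
    simpa using (of_move (.exchange [] [] [] (.cup (!a)) (.cross (!o) b (!a)))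
      (s := [b, !a]) (t := [!a, a, !a, b])).context
      (x := [b, !a]) (y := [!a, b]) [] [] [] [⟨[!a], .cap a, [b]⟩]
  have h3 : IsotopicIn [b, !a] [!a, b]
      [⟨[], .cross (!o) b (!a), []⟩, ⟨[], .cup (!a), [!a, b]⟩, ⟨[!a], .cap a, [b]⟩]
      [⟨[], .cross (!o) b (!a), []⟩] := by
    simpa using (of_move (.zigzagLeft (!a)) (s := [!a]) (t := [!a])).context
      (x := [b, !a]) (y := [!a, b]) [⟨[], .cross (!o) b (!a), []⟩] [] [b] []
  exact h1.trans (h2.trans h3)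

/-- Removing a curl on the right of a strand. -/
theorem isotopicIn_curlRight (o a : Bool) :
    IsotopicIn [a] [a]
      [⟨[a], .cup a, []⟩, ⟨[], .cross o a a, [!a]⟩, ⟨[a], .cap a, []⟩] [] := by
  have h1 : IsotopicIn [a] [a]
      [⟨[a], .cup a, []⟩, ⟨[], .cross o a a, [!a]⟩, ⟨[a], .cap a, []⟩]
      [⟨[], .cup a, [a]⟩, ⟨[a], .cross (!o) (!a) a, []⟩, ⟨[a], .cap a, []⟩] := by
    simpa using (of_move (.slideCup o a a) (s := [a]) (t := [a, a, !a])).context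
      (x := [a]) (y := [a]) [] [] [] [⟨[a], .cap a, []⟩]
  have h2 : IsotopicIn [a] [a]
      [⟨[], .cup a, [a]⟩, ⟨[a], .cross (!o) (!a) a, []⟩, ⟨[a], .cap a, []⟩]
      [⟨[], .cup a, [a]⟩, ⟨[a], .cap (!a), []⟩] := by
    have := of_move (.reidemeisterOneCap (!o) (!a)) (s := [!a, a]) (t := [])
    simpa using this.context
      (x := [a]) (y := [a]) [⟨[], .cup a, [a]⟩] [a] [] []
  exact h1.trans (h2.trans (of_move (.zigzagLeft a)))

/-- Removing a curl on the left of a strand. -/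
theorem isotopicIn_curlLeft (o a : Bool) :
    IsotopicIn [a] [a]
      [⟨[], .cup (!a), [a]⟩, ⟨[!a], .cross o a a, []⟩, ⟨[], .cap (!a), [a]⟩] [] := by
  have h1 : IsotopicIn [a] [a]
      [⟨[], .cup (!a), [a]⟩, ⟨[!a], .cross o a a, []⟩, ⟨[], .cap (!a), [a]⟩]
      [⟨[a], .cup (!a), []⟩, ⟨[], .cross (!o) a (!a), [a]⟩, ⟨[], .cap (!a), [a]⟩] := by
    have := of_move (.slideCup (!o) (!a) a) (s := [a]) (t := [!a, a, a])
    simpa using (this.context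
      (x := [a]) (y := [a]) [] [] [] [⟨[], .cap (!a), [a]⟩]).symm
  have h2 : IsotopicIn [a] [a]
      [⟨[a], .cup (!a), []⟩, ⟨[], .cross (!o) a (!a), [a]⟩, ⟨[], .cap (!a), [a]⟩]
      [⟨[a], .cup (!a), []⟩, ⟨[], .cap a, [a]⟩] := by
    simpa using (of_move (.reidemeisterOneCap (!o) a) (s := [a, !a]) (t := [])).context
      (x := [a]) (y := [a]) [⟨[a], .cup (!a), []⟩] [] [a] []
  exact h1.trans (h2.trans (of_move (.zigzagRight a)))

/-- Reversing the direction of a circle. -/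
theorem isotopicIn_circle (a : Bool) :
    IsotopicIn [] [] [⟨[], .cup (!a), []⟩, ⟨[], .cap (!a), []⟩]
      [⟨[], .cup a, []⟩, ⟨[], .cap a, []⟩] := by
  have h1 : IsotopicIn [] []
      [⟨[], .cup a, []⟩, ⟨[], .cross true a (!a), []⟩, ⟨[], .cap (!a), []⟩]
      [⟨[], .cup (!a), []⟩, ⟨[], .cap (!a), []⟩] := by
    simpa using (of_move (.reidemeisterOneCup true a) (s := []) (t := [!a, a])).context
      (x := []) (y := []) [] [] [] [⟨[], .cap (!a), []⟩]
  have h2 : IsotopicIn [] []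
      [⟨[], .cup a, []⟩, ⟨[], .cross true a (!a), []⟩, ⟨[], .cap (!a), []⟩]
      [⟨[], .cup a, []⟩, ⟨[], .cap a, []⟩] := by
    simpa using (of_move (.reidemeisterOneCap true a) (s := [a, !a]) (t := [])).context
      (x := []) (y := []) [⟨[], .cup a, []⟩] [] [] []
  exact h1.symm.trans h2

/-- Moving a piece on the left past a tangle diagram on the right. -/
theorem isotopicIn_exchangeLeft (g : Gen) (w : List Layer) : ∀ {s t : List Bool}, IsTangle s w t →
    IsotopicIn (g.src ++ s) (g.tgt ++ t) (⟨[], g, s⟩ :: w.map (Layer.shift g.tgt []))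
      (w.map (Layer.shift g.src []) ++ [⟨[], g, t⟩]) := by
  induction w with
  | nil => rintro s t rfl; exact .refl (by simp)
  | cons L w ih =>
    rintro s t ⟨rfl, h⟩
    have h1 := (of_move (.exchange [] L.left L.right g L.gen)
      (s := g.src ++ L.src) (t := g.tgt ++ L.tgt)).context (x := g.src ++ L.src)
      (y := g.tgt ++ t) [] [] [] (w.map (Layer.shift g.tgt []))
      (by simp) (by simpa using h.shift g.tgt [])
    have h2 := (ih h).context (x := g.src ++ L.src) (y := g.tgt ++ t)
      [⟨g.src ++ L.left, L.gen, L.right⟩] [] [] []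
    simpa [Function.comp_def] using h1.trans (by simpa using h2)

/-- Moving a piece on the right past a tangle diagram on the left. -/
theorem isotopicIn_exchangeRight (h : Gen) (w : List Layer) : ∀ {s t : List Bool},
    IsTangle s w t →
    IsotopicIn (s ++ h.src) (t ++ h.tgt) (w.map (Layer.shift [] h.src) ++ [⟨t, h, []⟩])
      (⟨s, h, []⟩ :: w.map (Layer.shift [] h.tgt)) := by
  induction w with
  | nil => rintro s t rfl; exact .refl (by simp)
  | cons L w ih =>
    rintro s t ⟨rfl, k⟩
    have h1 := (of_move (.exchange L.left L.right [] L.gen h)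
      (s := L.src ++ h.src) (t := L.tgt ++ h.tgt)).context (x := L.src ++ h.src)
      (y := t ++ h.tgt) [] [] [] (w.map (Layer.shift [] h.tgt))
      (by simp) (by simpa using k.shift [] h.tgt)
    have h2 := (ih k).context (x := L.src ++ h.src) (y := t ++ h.tgt)
      [⟨L.left, L.gen, L.right ++ h.src⟩] [] [] []
    simpa [Function.comp_def] using h2.trans (by simpa using h1)

/-! ### The skein relation for all orientations of a crossing -/

/-- Both crossings and their smoothing may be turned by a right angle, which exchanges the two
crossings. -/
theorem SkeinIn.rotate {o a b : Bool} {c : ℤ[X]} {w : List Layer}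
    (H : SkeinIn [a, b] [b, a] [⟨[], .cross o a b, []⟩] [⟨[], .cross (!o) a b, []⟩] c w) :
    SkeinIn [b, !a] [!a, b] [⟨[], .cross (!o) b (!a), []⟩] [⟨[], .cross o b (!a), []⟩] c
      (⟨[], .cup (!a), [b, !a]⟩ :: (w.map (Layer.shift [!a] [!a]) ++ [⟨[!a, b], .cap a, []⟩])) := by
  have h := H.context (x := [b, !a]) (y := [!a, b]) [⟨[], .cup (!a), [b, !a]⟩] [!a] [!a]
    [⟨[!a, b], .cap a, []⟩]
  have hw := h.choose_spec.choose_spec.choose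
  exact h.congr (by simpa using isotopicIn_rotate o a b)
    (by simpa using isotopicIn_rotate (!o) a b) (.refl hw)

theorem skeinIn_cross_true : SkeinIn [true, true] [true, true]
    [⟨[], .cross true true true, []⟩] [⟨[], .cross false true true, []⟩] X [] :=
  ⟨(upCrossing true).2, (upCrossing false).2, rfl, fun O =>
    sub_eq_iff_eq_add'.1 (conway_isConway.skein O)⟩

/-- The smoothing of two vertical strands becomes, after a quarter turn, a pair of
horizontal arcs. -/
theorem skeinIn_cross_true_false : SkeinIn [true, false] [false, true]
    [⟨[], .cross false true false, []⟩] [⟨[], .cross true true false, []⟩] X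
    [⟨[], .cap true, []⟩, ⟨[], .cup false, []⟩] := by
  refine skeinIn_cross_true.rotate.congr (.refl (by simp)) (.refl (by simp)) ?_
  exact of_move (.exchange [] [] [] (.cup false) (.cap true))

theorem skeinIn_cross_false : SkeinIn [false, false] [false, false]
    [⟨[], .cross true false false, []⟩] [⟨[], .cross false false false, []⟩] X [] := by
  refine skeinIn_cross_true_false.rotate.congr (.refl (by simp)) (.refl (by simp)) ?_
  have h := of_move (.zigzagLeft false) (s := [false]) (t := [false])
  exact (h.context (x := [false, false]) (y := [false, false]) [] [] [false]
    [⟨[false], .cup false, [false]⟩, ⟨[false, false], .cap true, []⟩]).trans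
      (h.context [] [false] [] [])

theorem skeinIn_cross_parallel (a : Bool) : SkeinIn [a, a] [a, a]
    [⟨[], .cross true a a, []⟩] [⟨[], .cross false a a, []⟩] X [] := by
  cases a
  · exact skeinIn_cross_false
  · exact skeinIn_cross_true

theorem skeinIn_cross_antiparallel (a : Bool) : SkeinIn [a, !a] [!a, a]
    [⟨[], .cross true a (!a), []⟩] [⟨[], .cross false a (!a), []⟩] (-X)
    [⟨[], .cap a, []⟩, ⟨[], .cup (!a), []⟩] := by
  cases a
  · refine (skeinIn_cross_false.rotate.congr (.refl (by simp)) (.refl (by simp)) ?_).symm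
    exact of_move (.exchange [] [] [] (.cup true) (.cap false))
  · exact skeinIn_cross_true_false.symm

/-! ### Twists -/

/-- The layers of `k` half-twists, right-handed if `k > 0` and left-handed if `k < 0`, starting from
strands of directions `a` and `b`. -/
def intTwist (k : ℤ) (a b : Bool) : List Layer := twistLayers (decide (0 < k)) k.natAbs a b

theorem intTwist_natCast (n : ℕ) (a b : Bool) : intTwist n a b = twistLayers true n a b := by
  cases n
  · rfl
  · simp only [intTwist, Int.natAbs_natCast]
    rw [decide_eq_true (by positivity)]

theorem intTwist_neg_natCast (n : ℕ) (a b : Bool) :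
    intTwist (-n) a b = twistLayers false n a b := by
  simp [intTwist, (Int.natCast_nonneg n).not_gt]

theorem intTwist_isTangle (k : ℤ) (a b : Bool) :
    IsTangle [a, b] (intTwist k a b) (if Even k then [a, b] else [b, a]) := by
  simpa only [intTwist, Int.natAbs_even] using twistLayers_isTangle (decide (0 < k)) k.natAbs a b

theorem isTangle_intTwist_parallel (k : ℤ) (a : Bool) :
    IsTangle [a, a] (intTwist k a a) [a, a] := by
  simpa using intTwist_isTangle k a a

/-- Changing one of `n + 2` half-twists cancels it with the next one. -/
theorem SkeinIn.twist {o a b : Bool} {c : ℤ[X]} {w : List Layer} {t : List Bool}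
    (H : SkeinIn [a, b] [b, a] [⟨[], .cross o a b, []⟩] [⟨[], .cross (!o) a b, []⟩] c w) (n : ℕ)
    (ht : IsTangle [a, b] (twistLayers o n a b) t) :
    SkeinIn [a, b] t (twistLayers o (n + 2) a b) (twistLayers o n a b) c
      (w ++ twistLayers o (n + 1) b a) := by
  have h := H.context (x := [a, b]) (y := t) [] [] [] (twistLayers o (n + 1) b a)
    (by simp) ⟨by simp, by simpa using ht⟩
  have hw : IsTangle [a, b] (w ++ twistLayers o (n + 1) b a) t := by
    simpa using h.choose_spec.choose_spec.choose
  have e : [] ++ (w.map (Layer.shift [] []) ++ twistLayers o (n + 1) b a) =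
    w ++ twistLayers o (n + 1) b a := by simp
  rw [e] at h
  refine h.congr (.refl ?_) ?_ (.refl hw)
  · simpa [twistLayers] using ht
  · simpa [twistLayers] using (of_move (.reidemeisterTwo (!o) a b)
      (s := [a, b]) (t := [a, b])).context (x := [a, b]) (y := t) [] [] []
        (twistLayers o n a b) (by simp) (by simpa using ht)

/-- The recurrence for parallel twists. For `k < 0` it is the relation for left-handed crossings,
read backwards. -/
theorem skeinIn_intTwist_parallel (k : ℤ) (a : Bool) :
    SkeinIn [a, a] [a, a] (intTwist (k + 1) a a) (intTwist (k - 1) a a) X (intTwist k a a) := by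
  obtain ⟨n, rfl | rfl⟩ := k.eq_nat_or_neg <;> rcases n with _ | n
  · exact skeinIn_cross_parallel a
  · have h := (skeinIn_cross_parallel a).twist n (t := [a, a])
      (by simpa using twistLayers_isTangle true n a a)
    rw [← intTwist_natCast, ← intTwist_natCast, List.nil_append, ← intTwist_natCast] at h
    push_cast at h ⊢
    rwa [add_sub_cancel_right, add_assoc, one_add_one_eq_two]
  · exact skeinIn_cross_parallel a
  · have h := ((skeinIn_cross_parallel a).symm.twist n (t := [a, a])
      (by simpa using twistLayers_isTangle false n a a)).symm
    rw [← intTwist_neg_natCast, ← intTwist_neg_natCast, List.nil_append,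
      ← intTwist_neg_natCast, neg_neg] at h
    push_cast at h ⊢
    convert h using 2 <;> ring

/-- Half-twists next to a minimum are curls. -/
theorem isotopicIn_cup_twistLayers (o : Bool) (n : ℕ) : ∀ a : Bool,
    IsotopicIn [] (if Even n then [a, !a] else [!a, a])
      (⟨[], .cup a, []⟩ :: twistLayers o n a (!a)) [⟨[], .cup (if Even n then a else !a), []⟩] := by
  induction n with
  | zero => intro a; exact .refl (by simp [twistLayers])
  | succ n ih =>
    intro a
    have ht : IsTangle [!a, a] (twistLayers o n (!a) a)
      (if Even (n + 1) then [a, !a] else [!a, a]) := by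
      by_cases hn : Even n <;> simpa [hn, Nat.even_add_one] using twistLayers_isTangle o n (!a) a
    have h1 := (of_move (.reidemeisterOneCup o a) (s := []) (t := [!a, a])).context (x := []) [] []
      [] (twistLayers o n (!a) a) (by simp) (by simpa using ht)
    have h2 := ih (!a)
    by_cases hn : Even n <;> simp [hn, Nat.even_add_one, twistLayers] at h1 h2 ⊢ <;>
      exact h1.trans h2

theorem isotopicIn_cup_intTwist (k : ℤ) (a : Bool) :
    IsotopicIn [] (if Even k then [a, !a] else [!a, a])
      (⟨[], .cup a, []⟩ :: intTwist k a (!a)) [⟨[], .cup (if Even k then a else !a), []⟩] := by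
  simpa only [intTwist, Int.natAbs_even] using
    isotopicIn_cup_twistLayers (decide (0 < k)) k.natAbs a

/-- The recurrence for antiparallel twists. The coefficient is `-X` because right-handed
antiparallel crossings are negative; the smoothing leaves the tangle `∞`, whose upper arc is directed
according to the parity of the number of curls on it. -/
theorem skeinIn_intTwist_antiparallel (k : ℤ) (a : Bool) :
    SkeinIn [a, !a] (if Even k then [!a, a] else [a, !a]) (intTwist (k + 1) a (!a))
      (intTwist (k - 1) a (!a)) (-X)
      [⟨[], .cap a, []⟩, ⟨[], .cup (if Even k then !a else a), []⟩] := by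
  suffices h : SkeinIn [a, !a] (if Even k then [!a, a] else [a, !a]) (intTwist (k + 1) a (!a))
      (intTwist (k - 1) a (!a)) (-X)
      ([⟨[], .cap a, []⟩, ⟨[], .cup (!a), []⟩] ++ intTwist k (!a) a) by
    obtain ⟨h1, h2, -⟩ := id h
    refine h.congr (.refl h1) (.refl h2) ?_
    simpa using (isotopicIn_cup_intTwist k (!a)).context (x := [a, !a])
      (y := if Even k then [!a, a] else [a, !a]) [⟨[], .cap a, []⟩] [] [] [] (by simp) (by simp)
  obtain ⟨n, rfl | rfl⟩ := k.eq_nat_or_neg <;> rcases n with _ | n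
  · exact skeinIn_cross_antiparallel a
  · have h := (skeinIn_cross_antiparallel a).twist n (twistLayers_isTangle true n a (!a))
    rw [← intTwist_natCast, ← intTwist_natCast, ← intTwist_natCast] at h
    have e : (if Even ((n + 1 : ℕ) : ℤ) then [!a, a] else [a, !a]) =
      if Even n then [a, !a] else [!a, a] := by
      by_cases hn : Even n <;> simp [hn]
    rw [e]
    push_cast at h ⊢
    rwa [add_sub_cancel_right, add_assoc, one_add_one_eq_two]
  · exact skeinIn_cross_antiparallel a
  · have h := ((skeinIn_cross_antiparallel a).symm.twist n
      (twistLayers_isTangle false n a (!a))).symm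
    rw [← intTwist_neg_natCast, ← intTwist_neg_natCast, ← intTwist_neg_natCast, neg_neg] at h
    have e : (if Even (-((n + 1 : ℕ) : ℤ)) then [!a, a] else [a, !a]) =
      if Even n then [a, !a] else [!a, a] := by
      simp only [even_neg]; by_cases hn : Even n <;> simp [hn]
    rw [e]
    push_cast at h ⊢
    convert h using 2 <;> ring

theorem skeinIn_evenTwist_antiparallel (p : ℤ) (a : Bool) :
    SkeinIn [a, !a] [a, !a] (intTwist (2 * p) a (!a)) [] (C p * -X)
      [⟨[], .cap a, []⟩, ⟨[], .cup a, []⟩] := by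
  refine SkeinIn.iterate (f := fun p => intTwist (2 * p) a (!a)) (fun p => ?_) p
  have h := skeinIn_intTwist_antiparallel (2 * p + 1) a
  have hp : ¬ Even (2 * p + 1) := by simp
  rw [if_neg hp, if_neg hp, add_sub_cancel_right, add_assoc] at h
  rwa [mul_add]

theorem skeinIn_oddTwist_antiparallel (p : ℤ) (a : Bool) :
    SkeinIn [a, !a] [!a, a] (intTwist (2 * p + 1) a (!a)) [⟨[], .cross true a (!a), []⟩]
      (C p * -X) [⟨[], .cap a, []⟩, ⟨[], .cup (!a), []⟩] := by
  refine SkeinIn.iterate (f := fun p => intTwist (2 * p + 1) a (!a)) (fun p => ?_) p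
  have h := skeinIn_intTwist_antiparallel (2 * (p + 1)) a
  have hp : Even (2 * (p + 1)) := by simp
  rw [if_pos hp, if_pos hp] at h
  convert h using 2
  ring

/-! ### Sums of tangles -/

/-- The layers of the sum of a tangle diagram `w` with bottom ends `a`, `b` and top ends `a'`, `b'`
and a tangle diagram `w'` with bottom ends `!b`, `d` and top ends `!b'`, `d'`. -/
def sumLayers (a b d a' b' d' : Bool) (w w' : List Layer) : List Layer :=
  ⟨[a], .cup b, [d]⟩ :: (w.map (Layer.shift [] [!b, d]) ++
    (w'.map (Layer.shift [a', b'] []) ++ [⟨[a'], .cap b', [d']⟩]))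

variable {a b d a' b' d' : Bool} {w w' w'' v : List Layer} {c : ℤ[X]}

theorem sumLayers_isTangle (h : IsTangle [a, b] w [a', b'])
    (h' : IsTangle [!b, d] w' [!b', d']) :
    IsTangle [a, d] (sumLayers a b d a' b' d' w w') [a', d'] :=
  (tangleSum ⟨w, h⟩ ⟨w', h'⟩ rfl rfl).2

theorem Outside.fill_tangleSum {e e' : Bool} (O : Outside [a, d] [a', d'])
    (T : Tangle [a, b] [a', b']) (T' : Tangle [e, d] [e', d']) (he : e = !b) (he' : e' = !b') :
    O.fill (tangleSum T T' he he') =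
      O.fill ⟨_, sumLayers_isTangle (w' := T'.1) T.2 (by subst he he'; exact T'.2)⟩ := by
  subst he he'
  rfl

theorem SkeinIn.sumLeft (H : SkeinIn [a, b] [a', b'] w w' c w'')
    (h : IsTangle [!b, d] v [!b', d']) :
    SkeinIn [a, d] [a', d'] (sumLayers a b d a' b' d' w v) (sumLayers a b d a' b' d' w' v) c
      (sumLayers a b d a' b' d' w'' v) := by
  have hv : IsTangle [a', b', !b', d'] [⟨[a'], .cap b', [d']⟩] [a', d'] := by simp
  exact SkeinIn.context H (x := [a, d]) (y := [a', d']) [⟨[a], .cup b, [d]⟩] [] [!b, d]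
    (v.map (Layer.shift [a', b'] []) ++ [⟨[a'], .cap b', [d']⟩]) (by simp)
    (by simpa using (h.shift [a', b'] []).append hv)

theorem SkeinIn.sumRight (H : SkeinIn [!b, d] [!b', d'] w w' c w'')
    (h : IsTangle [a, b] v [a', b']) :
    SkeinIn [a, d] [a', d'] (sumLayers a b d a' b' d' v w) (sumLayers a b d a' b' d' v w') c
      (sumLayers a b d a' b' d' v w'') := by
  simpa [sumLayers] using H.context (x := [a, d]) (y := [a', d'])
    (⟨[a], .cup b, [d]⟩ :: v.map (Layer.shift [] [!b, d])) [a', b'] [] [⟨[a'], .cap b', [d']⟩]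
    (by simpa using h.shift [] [!b, d]) (by simp)

/-- The tangle `∞` is a right unit for the sum. -/
theorem isotopicIn_sum_infty (h : IsTangle [a, !a] w [a', !a']) :
    IsotopicIn [a, !a] [a', !a'] (sumLayers a (!a) (!a) a' (!a') (!a') w
      [⟨[], .cap a, []⟩, ⟨[], .cup a', []⟩]) w := by
  have h1 := (isotopicIn_exchangeRight (.cap a) w h).context (x := [a, !a]) (y := [a', !a'])
    [⟨[a], .cup (!a), [!a]⟩] [] [] [⟨[a', !a'], .cup a', []⟩, ⟨[a'], .cap (!a'), [!a']⟩]
  have h2 := (of_move (.zigzagLeft (!a)) (s := [!a]) (t := [!a])).context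
    (x := [a, !a]) (y := [a', !a']) [] [a] []
    (w ++ [⟨[a', !a'], .cup a', []⟩, ⟨[a'], .cap (!a'), [!a']⟩]) (by simp) (h.append (by simp))
  have h3 := (of_move (.zigzagRight (!a')) (s := [!a']) (t := [!a'])).context
    (x := [a, !a]) (y := [a', !a']) w [a'] [] [] h
  simp at h1 h2 h3
  simpa [sumLayers] using h1.trans (h2.trans h3)

/-- The tangle `∞` is a left unit for the sum. -/
theorem isotopicIn_infty_sum (h : IsTangle [a, !a] w [a', !a']) :
    IsotopicIn [a, !a] [a', !a'] (sumLayers a (!a) (!a) a' (!a') (!a')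
      [⟨[], .cap a, []⟩, ⟨[], .cup a', []⟩] w) w := by
  have hv : IsTangle [a', !a', a', !a'] [⟨[a'], .cap (!a'), [!a']⟩] [a', !a'] := by simp
  have h1 := (of_move (.zigzagRight a) (s := [a]) (t := [a])).context
    (x := [a, !a]) (y := [a', !a']) [] [] [!a]
    (⟨[], .cup a', [a, !a]⟩ :: (w.map (Layer.shift [a', !a'] []) ++ [⟨[a'], .cap (!a'), [!a']⟩]))
    (by simp)
    ⟨by simp, by simpa using (h.shift [a', !a'] []).append hv⟩
  have h2 := (isotopicIn_exchangeLeft (.cup a') w h).context (x := [a, !a]) (y := [a', !a'])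
    [] [] [] [⟨[a'], .cap (!a'), [!a']⟩]
  have h3 := (of_move (.zigzagLeft a') (s := [a']) (t := [a'])).context
    (x := [a, !a]) (y := [a', !a']) w [] [!a'] [] h
  simp at h1 h2 h3
  simpa [sumLayers] using h1.trans (h2.trans h3)

/-- Opposite crossings next to each other cancel. -/
theorem isotopicIn_sum_cross (o a b : Bool) :
    IsotopicIn [a, !a] [b, !b] (sumLayers a b (!a) b a (!b)
      [⟨[], .cross o a b, []⟩] [⟨[], .cross (!o) (!b) (!a), []⟩])
      [⟨[], .cap a, []⟩, ⟨[], .cup b, []⟩] := by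
  -- The left crossing slides along the minimum, the right one along the maximum, so that both
  -- involve the same two strands.
  have h1 := (of_move (.slideCup o b a) (s := [a]) (t := [b, a, !b])).context
    (x := [a, !a]) (y := [b, !b]) [] [] [!a]
    [⟨[b, a], .cross (!o) (!b) (!a), []⟩, ⟨[b], .cap a, [!b]⟩]
  have h2 := (of_move (.slideCap o a (!b)) (s := [a, !b, !a]) (t := [!b])).symm.context
    (x := [a, !a]) (y := [b, !b]) [⟨[], .cup b, [a, !a]⟩, ⟨[b], .cross (!o) (!b) a, [!a]⟩] [b] [] []
  have h3 := (of_move (.reidemeisterTwo (!o) (!b) a) (s := [!b, a]) (t := [!b, a])).context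
    (x := [a, !a]) (y := [b, !b]) [⟨[], .cup b, [a, !a]⟩] [b] [!a] [⟨[b, !b], .cap a, []⟩]
  have h4 := of_move (.exchange [] [] [] (.cup b) (.cap a)) (s := [a, !a]) (t := [b, !b])
  simp at h1 h2 h3 h4
  simpa [sumLayers] using h1.trans (h2.trans (h3.trans h4))

/-- A crossing of parallel strands becomes a curl once its right ends are joined. -/
theorem isotopicIn_cross_sum_vertical (o a : Bool) :
    IsotopicIn [a, !a] [a, !a] (sumLayers a a (!a) a a (!a) [⟨[], .cross o a a, []⟩] []) [] := by
  simpa [sumLayers] using (isotopicIn_curlRight o a).context (x := [a, !a]) (y := [a, !a])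
    [] [] [!a] []

theorem isotopicIn_vertical_sum_cross (o a : Bool) :
    IsotopicIn [a, !a] [a, !a]
      (sumLayers a a (!a) a a (!a) [] [⟨[], .cross o (!a) (!a), []⟩]) [] := by
  simpa [sumLayers] using (isotopicIn_curlLeft o (!a)).context (x := [a, !a]) (y := [a, !a])
    [] [a] [] []

/-! ### Closures -/

theorem IsotopicIn.conway_closed_eq {w w' : List Layer} (H : IsotopicIn [] [] w w')
    (h : IsTangle [] w []) (h' : IsTangle [] w' []) : conway ⟨w, h⟩ = conway ⟨w', h'⟩ := by
  simpa [Outside.fill] using H.conway_eq h h' ⟨[], [], ⟨[], rfl⟩, ⟨[], rfl⟩⟩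

theorem conway_circle (a : Bool) (h : IsTangle [] [⟨[], .cup a, []⟩, ⟨[], .cap a, []⟩] []) :
    conway ⟨[⟨[], .cup a, []⟩, ⟨[], .cap a, []⟩], h⟩ = 1 := by
  cases a
  · exact ((isotopicIn_circle true).conway_closed_eq h circle.2).trans conway_isConway.unknot
  · exact conway_isConway.unknot

/-- The outside of the disc in the closure of a tangle diagram. -/
def closureOutside (a b : Bool) : Outside [a, b] [a, b] where
  left := [!a]
  right := [!b]
  below := ⟨[⟨[], .cup (!a), []⟩, ⟨[!a, a], .cup b, []⟩], by simp⟩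
  above := ⟨[⟨[!a, a], .cap b, []⟩, ⟨[], .cap (!a), []⟩], by simp⟩

theorem conway_closure_cross (o a : Bool) (h : IsTangle [a, a] [⟨[], .cross o a a, []⟩] [a, a]) :
    conway (closure ⟨_, h⟩) = 1 := by
  have H := (isotopicIn_curlRight o a).context (x := []) (y := []) [⟨[], .cup (!a), []⟩] [!a] []
    [⟨[], .cap (!a), []⟩]
  exact (H.conway_closed_eq (closure ⟨_, h⟩).2 (by simp)).trans (conway_circle _ _)

/-- Both closures of a crossing are unknots, so the skein relation makes the closure of two vertical
strands vanish. -/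
theorem conway_closure_vertical (a : Bool) (h : IsTangle [a, a] [] [a, a]) :
    conway (closure ⟨[], h⟩) = 0 := by
  have H : conway (closure _) = conway (closure _) + X * conway (closure _) :=
    (skeinIn_cross_parallel a).conway_eq (by simp) (by simp) h (closureOutside a a)
  have H' : 1 = 1 + X * conway (closure ⟨[], h⟩) :=
    (conway_closure_cross true a (by simp)).symm.trans
      (H.trans (congrArg (· + _) (conway_closure_cross false a (by simp))))
  simpa using H'

/-- Reversing the inner circle reduces this to parallel strands. -/
theorem conway_closure_vertical_antiparallel (a : Bool) (h : IsTangle [a, !a] [] [a, !a]) :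
    conway (closure ⟨[], h⟩) = 0 := by
  have H := (isotopicIn_circle a).context (x := []) (y := []) [⟨[], .cup (!a), []⟩] [!a, a] []
    [⟨[], .cap (!a), []⟩]
  exact (H.conway_closed_eq (closure ⟨_, h⟩).2 (closure ⟨[], by simp⟩).2).trans
    (conway_closure_vertical a (by simp))

theorem conway_closure_inftyAnti (a : Bool)
    (h : IsTangle [a, !a] [⟨[], .cap a, []⟩, ⟨[], .cup a, []⟩] [a, !a]) :
    conway (closure ⟨_, h⟩) = 1 := by
  have h1 := (of_move (.zigzagRight a) (s := [a]) (t := [a])).context (x := []) (y := [])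
    [⟨[], .cup (!a), []⟩] [!a] []
    [⟨[!a], .cup a, [a]⟩, ⟨[!a, a], .cap (!a), []⟩, ⟨[], .cap (!a), []⟩]
  have h2 := (of_move (.zigzagLeft a) (s := [a]) (t := [a])).context (x := []) (y := [])
    [⟨[], .cup (!a), []⟩] [!a] [] [⟨[], .cap (!a), []⟩]
  simp at h1 h2
  have H := ((h1.trans h2).conway_closed_eq (by simp) (by simp)).trans
    (conway_circle (!a) (by simp))
  simpa [closure] using H

/-- The sum contains a split circle, so it vanishes: the skein relation compares two curls on the
left strand, which are isotopic. -/
theorem conway_sum_vertical (a : Bool) (O : Outside [a, !a] [a, !a])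
    (h : IsTangle [a, !a] (sumLayers a a (!a) a a (!a) [] []) [a, !a]) :
    conway (O.fill ⟨_, h⟩) = 0 := by
  have h0 : IsTangle [!a, !a] [] [!a, !a] := rfl
  have H := ((skeinIn_cross_parallel a).sumLeft h0).conway_eq
    (sumLayers_isTangle (by simp) h0) (sumLayers_isTangle (by simp) h0) h O
  have hv : IsTangle [a, !a] [] [a, !a] := rfl
  rw [(isotopicIn_cross_sum_vertical true a).conway_eq _ hv,
    (isotopicIn_cross_sum_vertical false a).conway_eq _ hv] at H
  simpa using H

/-- Reversing the split circle reduces this to parallel strands. -/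
theorem conway_sum_vertical_antiparallel (a : Bool) (O : Outside [a, !a] [a, !a])
    (h : IsTangle [a, !a] (sumLayers a (!a) (!a) a (!a) (!a) [] []) [a, !a]) :
    conway (O.fill ⟨_, h⟩) = 0 := by
  have H := (isotopicIn_circle a).context (x := [a, !a]) (y := [a, !a]) [] [a] [!a] []
  exact (H.conway_eq h (sumLayers_isTangle (a := a) (w := []) (w' := []) rfl rfl) O).trans
    (conway_sum_vertical a O _)

/-! ### The polynomials `Φ` and `Ψ` solve the recurrence of parallel twists -/

theorem choose_add_eq_zero {p : ℤ} {i m : ℕ} (h : p.natAbs ≤ i) (hm : p + i < m) :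
    Ring.choose (p + i) m = 0 := by
  obtain ⟨k, hk⟩ := Int.eq_ofNat_of_zero_le (show 0 ≤ p + i by omega)
  rw [hk, Ring.choose_natCast, Nat.choose_eq_zero_of_lt (by omega), Nat.cast_zero]

theorem Phi_eq_sum {p : ℤ} {N : ℕ} (h : p.natAbs ≤ N) :
    Phi p = ∑ i ∈ Finset.range N, C (Ring.choose (p + i) (2 * i + 1)) * X ^ (2 * i + 1) := by
  refine Finset.sum_subset (Finset.range_subset_range.2 h) fun i _ hi => ?_
  rw [Finset.mem_range, not_lt] at hi
  rw [choose_add_eq_zero hi (by push_cast; omega), C_0, zero_mul]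

theorem Psi_eq_sum {p : ℤ} {N : ℕ} (h : p.natAbs + 1 ≤ N) :
    Psi p = ∑ i ∈ Finset.range N, C (Ring.choose (p + i) (2 * i)) * X ^ (2 * i) := by
  refine Finset.sum_subset (Finset.range_subset_range.2 h) fun i _ hi => ?_
  rw [Finset.mem_range, not_lt] at hi
  rw [choose_add_eq_zero (by omega) (by push_cast; omega), C_0, zero_mul]

theorem Phi_add_one (p : ℤ) : Phi (p + 1) = Phi p + X * Psi p := by
  rw [Phi_eq_sum (N := p.natAbs + 1) (by omega), Phi_eq_sum (p := p) (N := p.natAbs + 1) (by omega),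
    Psi, Finset.mul_sum, ← Finset.sum_add_distrib]
  refine Finset.sum_congr rfl fun i _ => ?_
  rw [add_right_comm, Ring.choose_succ_succ, C_add]
  ring

theorem Psi_add_one (p : ℤ) : Psi (p + 1) = Psi p + X * Phi (p + 1) := by
  rw [Phi_eq_sum (N := p.natAbs + 1) (by omega), Psi_eq_sum (N := p.natAbs + 1 + 1) (by omega),
    Psi_eq_sum (p := p) (N := p.natAbs + 1 + 1) (by omega), Finset.sum_range_succ' _ (p.natAbs + 1),
    Finset.sum_range_succ' _ (p.natAbs + 1), add_right_comm _ (C _ * X ^ (2 * 0)), Finset.mul_sum,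
    ← Finset.sum_add_distrib]
  congr 1
  · refine Finset.sum_congr rfl fun i _ => ?_
    have e : p + 1 + ((i + 1 : ℕ) : ℤ) = p + ((i + 1 : ℕ) : ℤ) + 1 := by ring
    have e' : p + 1 + (i : ℤ) = p + ((i + 1 : ℕ) : ℤ) := by push_cast; ring
    rw [e, e', mul_add_one, Ring.choose_succ_succ, C_add]
    ring
  · simp

theorem Phi_zero : Phi 0 = 0 := by simp [Phi]

theorem Psi_zero : Psi 0 = 1 := by simp [Psi]

theorem Phi_neg_and_Psi_neg (p : ℤ) : Phi (-p) = -Phi p ∧ Psi (-p - 1) = Psi p := by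
  have key (q : ℤ) : Phi (-q) = Phi (-q - 1) + X * Psi (-q - 1) ∧
      Psi (-q) = Psi (-q - 1) + X * Phi (-q) := by
    have h := Phi_add_one (-q - 1)
    have h' := Psi_add_one (-q - 1)
    rw [sub_add_cancel] at h h'
    exact ⟨h, h'⟩
  induction p with
  | zero =>
    have h := (key 0).2
    simp only [neg_zero, Phi_zero, mul_zero, add_zero] at h ⊢
    exact ⟨trivial, h.symm⟩
  | succ n ih =>
    have h1 := (key n).1
    have h2 := (key (n + 1)).2
    have h3 := Phi_add_one n
    have h4 := Psi_add_one n
    have e : -((n : ℤ) + 1) = -n - 1 := by ring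
    rw [e] at h2 ⊢
    have h5 : Phi (-(n : ℤ) - 1) = -Phi (n + 1) := by
      linear_combination -h1 + ih.1 - X * ih.2 + h3
    exact ⟨h5, by linear_combination -h2 + ih.2 - X * h5 - h4⟩
  | pred n ih =>
    have h1 := (key n).1
    have h2 := (key n).2
    have h3 := Phi_add_one (n : ℤ)
    have e : -(-(n : ℤ) - 1) = n + 1 := by ring
    rw [e, add_sub_cancel_right]
    rw [neg_neg] at ih
    have h5 : Psi (n : ℤ) = Psi (-(n : ℤ) - 1) := by
      have h6 := Psi_add_one ((n : ℤ) - 1)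
      rw [sub_add_cancel] at h6
      linear_combination h6 + ih.2 + X * ih.1 + h2
    exact ⟨by linear_combination h3 + ih.1 - h1 + X * h5, h5⟩

/-- The coefficient `Psi p - X * Phi p` is `Psi (p - 1)`. -/
theorem eq_Phi_Psi_of_recurrence {f : ℤ → ℤ[X]} (h : ∀ k, f (k + 1) = f (k - 1) + X * f k)
    (p : ℤ) : f (2 * p) = Phi p * f 1 + (Psi p - X * Phi p) * f 0 ∧
      f (2 * p + 1) = Psi p * f 1 + Phi p * f 0 := by
  induction p with
  | zero => simp [Phi_zero, Psi_zero]
  | succ n ih =>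
    have h1 := h (2 * n + 1)
    have h2 := h (2 * (n + 1))
    have e : (2 * (n + 1) - 1 : ℤ) = 2 * n + 1 := by ring
    have e' : (2 * n + 1 + 1 : ℤ) = 2 * (n + 1) := by ring
    rw [e] at h2
    rw [add_sub_cancel_right, e'] at h1
    rw [h2, h1, ih.1, ih.2, Psi_add_one, Phi_add_one]
    constructor <;> ring
  | pred n ih =>
    have h1 := h (2 * (-n - 1) + 1)
    have h2 := h (2 * -n)
    have e : (2 * (-n - 1) + 1 + 1 : ℤ) = 2 * -n := by ring
    have e' : (2 * -n - 1 : ℤ) = 2 * (-n - 1) + 1 := by ring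
    rw [e'] at h2
    rw [add_sub_cancel_right, e] at h1
    have h3 := Phi_add_one (-n - 1)
    have h4 := Psi_add_one (-n - 1)
    rw [sub_add_cancel] at h3 h4
    have h5 : f (2 * (-n - 1) + 1) = Psi (-n - 1) * f 1 + Phi (-n - 1) * f 0 := by
      rw [ih.1, ih.2] at h2
      linear_combination -h2 + f 1 * h4 + f 0 * h3 - X * f 0 * h4
    refine ⟨?_, h5⟩
    rw [ih.1, h5] at h1
    linear_combination -h1 + f 1 * h3 + f 0 * h4

/-! ### Sums of opposite twists -/

/-- The contributions of the untwisted strands, one from expanding each summand, cancel. -/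
theorem conway_sum_evenTwist_antiparallel (p : ℤ) (a : Bool) (O : Outside [a, !a] [a, !a])
    (h : IsTangle [a, !a] (sumLayers a (!a) (!a) a (!a) (!a) (intTwist (2 * p) a (!a))
      (intTwist (-(2 * p)) a (!a))) [a, !a]) :
    conway (O.fill ⟨_, h⟩) = -(C p ^ 2 * X ^ 2) * conway (O.fill (inftyAnti a)) := by
  have hy : IsTangle [a, !a] (intTwist (-(2 * p)) a (!a)) [a, !a] := by
    simpa using intTwist_isTangle (-(2 * p)) a (!a)
  have hv : IsTangle [a, !a] [] [a, !a] := rfl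
  have hi : IsTangle [a, !a] [⟨[], .cap a, []⟩, ⟨[], .cup a, []⟩] [a, !a] := (inftyAnti a).2
  have H := skeinIn_evenTwist_antiparallel p a
  have H' := skeinIn_evenTwist_antiparallel (-p) a
  rw [mul_neg 2 p] at H'
  have sum {w w' : List Layer} (h : IsTangle [a, !a] w [a, !a]) (h' : IsTangle [a, !a] w' [a, !a]) :
      IsTangle [a, !a] (sumLayers a (!a) (!a) a (!a) (!a) w w') [a, !a] :=
    sumLayers_isTangle h (by simpa using h')
  have h1 := (H.sumLeft (d := !a) (d' := !a) (by simpa using hy)).conway_eq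
    h (sum hv hy) (sum hi hy) O
  have h2 := (SkeinIn.sumRight (b := !a) (b' := !a) (by rw [Bool.not_not]; exact H') hv).conway_eq
    (sum hv hy) (sum hv hv) (sum hv hi) O
  rw [(isotopicIn_infty_sum hy).conway_eq _ hy, H'.conway_eq hy hv hi] at h1
  rw [(isotopicIn_sum_infty hv).conway_eq _ hv, conway_sum_vertical_antiparallel] at h2
  rw [h1, h2, C_neg]
  change _ = -(C p ^ 2 * X ^ 2) * conway (O.fill ⟨_, hi⟩)
  ring

/-- Both summands are expanded around a right-handed crossing, `-(2 * p + 1)` being the odd number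
`2 * (-p - 1) + 1`. -/
theorem conway_sum_oddTwist_antiparallel (p : ℤ) (a : Bool) (O : Outside [a, !a] [!a, a])
    (h : IsTangle [a, !a] (sumLayers a (!a) (!a) (!a) a a (intTwist (2 * p + 1) a (!a))
      (intTwist (-(2 * p + 1)) a (!a))) [!a, a]) :
    conway (O.fill ⟨_, h⟩) = (1 - C (p * (p + 1)) * X ^ 2) * conway (O.fill (inftyPar a)) := by
  have hy : IsTangle [a, !a] (intTwist (-(2 * p + 1)) a (!a)) [!a, a] := by
    have h := intTwist_isTangle (-(2 * p + 1)) a (!a)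
    rwa [if_neg (by rw [even_neg]; simp)] at h
  have hc (o : Bool) : IsTangle [a, !a] [⟨[], .cross o a (!a), []⟩] [!a, a] := by simp
  have hi : IsTangle [a, !a] [⟨[], .cap a, []⟩, ⟨[], .cup (!a), []⟩] [!a, a] := by simp
  have H := skeinIn_oddTwist_antiparallel p a
  have H' := skeinIn_oddTwist_antiparallel (-p - 1) a
  have e : 2 * (-p - 1) + 1 = -(2 * p + 1) := by ring
  rw [e] at H'
  have sum {w w' : List Layer} (h : IsTangle [a, !a] w [!a, a]) (h' : IsTangle [a, !a] w' [!a, a]) :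
      IsTangle [a, !a] (sumLayers a (!a) (!a) (!a) a a w w') [!a, a] :=
    sumLayers_isTangle h (by simpa using h')
  have h1 := (H.sumLeft (d := !a) (d' := a) (by simpa using hy)).conway_eq
    h (sum (hc _) hy) (sum hi hy) O
  have h2 := (SkeinIn.sumRight (b := !a) (b' := a) (by rw [Bool.not_not]; exact H')
    (hc true)).conway_eq
    (sum (hc _) hy) (sum (hc _) (hc _)) (sum (hc _) hi) O
  have h3 := (SkeinIn.sumRight (b := !a) (b' := a)
    (by simpa using skeinIn_cross_antiparallel a) (hc true)).conway_eq
    (sum (hc _) (hc _)) (sum (hc _) (hc _)) (sum (hc _) hi) O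
  have i1 := isotopicIn_infty_sum (a := a) (a' := !a) (w := intTwist (-(2 * p + 1)) a (!a))
    (by rwa [Bool.not_not])
  have i2 := isotopicIn_sum_infty (a := a) (a' := !a) (w := [⟨[], .cross true a (!a), []⟩])
    (by simp)
  have i3 := isotopicIn_sum_cross true a (!a)
  simp only [Bool.not_not, Bool.not_true] at i1 i2 i3
  rw [i1.conway_eq _ hy, H'.conway_eq hy (hc _) hi] at h1
  rw [i2.conway_eq _ (hc _)] at h2 h3
  rw [i3.conway_eq _ hi] at h3
  rw [h1, h2, h3]
  change _ = _ * conway (O.fill ⟨_, hi⟩)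
  simp only [C_sub, C_neg, C_mul, C_add, C_1]
  ring

theorem conway_sum_parallel (p : ℤ) (a : Bool) (O : Outside [a, !a] [a, !a]) :
    (∀ h, conway (O.fill ⟨sumLayers a a (!a) a a (!a) (intTwist (2 * p) a a)
      (intTwist (-(2 * p)) (!a) (!a)), h⟩) = -Phi p ^ 2 * conway (O.fill (inftyAnti a))) ∧
    ∀ h, conway (O.fill ⟨sumLayers a a (!a) a a (!a) (intTwist (2 * p + 1) a a)
      (intTwist (-(2 * p + 1)) (!a) (!a)), h⟩) = Psi p ^ 2 * conway (O.fill (inftyAnti a)) := by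
  have ht (j k : ℤ) := sumLayers_isTangle (isTangle_intTwist_parallel j a)
    (isTangle_intTwist_parallel k (!a))
  let f (j k : ℤ) : ℤ[X] := conway (O.fill ⟨_, ht j k⟩)
  have hl (j k : ℤ) : f (j + 1) k = f (j - 1) k + X * f j k :=
    ((skeinIn_intTwist_parallel j a).sumLeft (isTangle_intTwist_parallel k (!a))).conway_eq _ _ _ O
  have hr (j k : ℤ) : f j (k + 1) = f j (k - 1) + X * f j k :=
    ((skeinIn_intTwist_parallel k (!a)).sumRight (isTangle_intTwist_parallel j a)).conway_eq _ _ _ O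
  have hv : IsTangle [a, !a] [] [a, !a] := rfl
  have h00 : f 0 0 = 0 := conway_sum_vertical a O _
  have h10 : f 1 0 = conway (O.fill ⟨[], hv⟩) :=
    (isotopicIn_cross_sum_vertical true a).conway_eq _ _ O
  have h01 : f 0 1 = conway (O.fill ⟨[], hv⟩) :=
    (isotopicIn_vertical_sum_cross true a).conway_eq _ _ O
  have h11 : f 1 (-1) = conway (O.fill (inftyAnti a)) :=
    (isotopicIn_sum_cross true a a).conway_eq _ (inftyAnti a).2 O
  have h11' := hr 1 0
  simp only [zero_add, zero_sub, h11, h10] at h11'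
  -- The recurrence in the first variable gives the values at `k = 0` and `k = 1`, from which the
  -- recurrence in the second variable gives the value at `k = -j`.
  have l0 := eq_Phi_Psi_of_recurrence (f := fun j => f j 0) (fun j => hl j 0) p
  have l1 := eq_Phi_Psi_of_recurrence (f := fun j => f j 1) (fun j => hl j 1) p
  simp only [h00, h10, h01, h11', mul_zero, add_zero] at l0 l1
  have n1 := (Phi_neg_and_Psi_neg p).1
  have n2 := (Phi_neg_and_Psi_neg p).2
  have n3 := Phi_add_one (-p - 1)
  have n4 := Psi_add_one (-p - 1)
  rw [sub_add_cancel] at n3 n4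
  constructor <;> intro _
  · have r := (eq_Phi_Psi_of_recurrence (hr (2 * p)) (-p)).1
    rw [mul_neg, l0.1, l1.1] at r
    refine r.trans ?_
    rw [n4, n2, n1]
    ring
  · have r := (eq_Phi_Psi_of_recurrence (hr (2 * p + 1)) (-p - 1)).2
    have e : 2 * (-p - 1) + 1 = -(2 * p + 1) := by ring
    rw [e, l0.2, l1.2] at r
    refine r.trans ?_
    have n5 : Phi (-p - 1) = -Phi p - X * Psi p := by linear_combination n1 - n3 - X * n2
    rw [n5, n2]
    ring

/-! ### Torus links -/

theorem conway_closure_evenTwist_antiparallel (p : ℤ) (a : Bool)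
    (h : IsTangle [a, !a] (intTwist (2 * p) a (!a)) [a, !a]) :
    conway (closure ⟨_, h⟩) = -(C p * X) := by
  have hv : IsTangle [a, !a] [] [a, !a] := rfl
  have H : conway (closure _) = conway (closure _) + C p * -X * conway (closure _) :=
    (skeinIn_evenTwist_antiparallel p a).conway_eq h hv (inftyAnti a).2 (closureOutside a (!a))
  refine H.trans ?_
  have h1 := conway_closure_vertical_antiparallel a hv
  have h2 := conway_closure_inftyAnti a (inftyAnti a).2
  linear_combination h1 + C p * -X * h2

theorem conway_closure_parallel (p : ℤ) (a : Bool) :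
    (∀ h : IsTangle [a, a] (intTwist (2 * p) a a) [a, a], conway (closure ⟨_, h⟩) = Phi p) ∧
    ∀ h : IsTangle [a, a] (intTwist (2 * p + 1) a a) [a, a], conway (closure ⟨_, h⟩) = Psi p := by
  let f (k : ℤ) : ℤ[X] := conway (closure ⟨_, isTangle_intTwist_parallel k a⟩)
  have hf (k : ℤ) : f (k + 1) = f (k - 1) + X * f k :=
    (skeinIn_intTwist_parallel k a).conway_eq _ _ _ (closureOutside a a)
  have h0 : f 0 = 0 := conway_closure_vertical a _
  have h1 : f 1 = 1 := conway_closure_cross true a _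
  have h := eq_Phi_Psi_of_recurrence hf p
  simp only [h0, h1, mul_one, mul_zero, add_zero] at h
  exact ⟨fun _ => h.1, fun _ => h.2⟩

end LinkDiag

theorem mainTheorem9 (p : ℤ) (a c c' : Bool) :
    -- antiparallel strands, an even number of half-twists
    (∀ O : LinkDiag.Outside [a, !a] [a, !a],
      LinkDiag.conway (O.fill (LinkDiag.tangleSum
          (LinkDiag.evenTwist (2 * p) (even_two_mul p) a (!a))
          (LinkDiag.evenTwist (-(2 * p)) (even_two_mul p).neg a (!a)) (by simp) (by simp))) =
        LinkDiag.conway (LinkDiag.closure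
            (LinkDiag.evenTwist (2 * p) (even_two_mul p) c (!c))) *
          LinkDiag.conway (LinkDiag.closure
            (LinkDiag.evenTwist (-(2 * p)) (even_two_mul p).neg c' (!c'))) *
          LinkDiag.conway (O.fill (LinkDiag.inftyAnti a)) ∧
      LinkDiag.conway (O.fill (LinkDiag.tangleSum
          (LinkDiag.evenTwist (2 * p) (even_two_mul p) a (!a))
          (LinkDiag.evenTwist (-(2 * p)) (even_two_mul p).neg a (!a)) (by simp) (by simp))) =
        -(Polynomial.C p ^ 2 * Polynomial.X ^ 2) *
          LinkDiag.conway (O.fill (LinkDiag.inftyAnti a))) ∧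
    -- antiparallel strands, an odd number of half-twists
    (∀ O : LinkDiag.Outside [a, !a] [!a, a],
      LinkDiag.conway (O.fill (LinkDiag.tangleSum
          (LinkDiag.oddTwist (2 * p + 1) (odd_two_mul_add_one p) a (!a))
          (LinkDiag.oddTwist (-(2 * p + 1)) (odd_two_mul_add_one p).neg a (!a))
          (by simp) (by simp))) =
        (1 - Polynomial.C (p * (p + 1)) * Polynomial.X ^ 2) *
          LinkDiag.conway (O.fill (LinkDiag.inftyPar a))) ∧
    -- parallel strands, an even number of half-twists
    (∀ O : LinkDiag.Outside [a, !a] [a, !a],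
      LinkDiag.conway (O.fill (LinkDiag.tangleSum
          (LinkDiag.evenTwist (2 * p) (even_two_mul p) a a)
          (LinkDiag.evenTwist (-(2 * p)) (even_two_mul p).neg (!a) (!a)) rfl rfl)) =
        LinkDiag.conway (LinkDiag.closure
            (LinkDiag.evenTwist (2 * p) (even_two_mul p) c c)) *
          LinkDiag.conway (LinkDiag.closure
            (LinkDiag.evenTwist (-(2 * p)) (even_two_mul p).neg c' c')) *
          LinkDiag.conway (O.fill (LinkDiag.inftyAnti a)) ∧
      LinkDiag.conway (O.fill (LinkDiag.tangleSum
          (LinkDiag.evenTwist (2 * p) (even_two_mul p) a a)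
          (LinkDiag.evenTwist (-(2 * p)) (even_two_mul p).neg (!a) (!a)) rfl rfl)) =
        -LinkDiag.Phi p ^ 2 * LinkDiag.conway (O.fill (LinkDiag.inftyAnti a))) ∧
    -- parallel strands, an odd number of half-twists
    (∀ O : LinkDiag.Outside [a, !a] [a, !a],
      LinkDiag.conway (O.fill (LinkDiag.tangleSum
          (LinkDiag.oddTwist (2 * p + 1) (odd_two_mul_add_one p) a a)
          (LinkDiag.oddTwist (-(2 * p + 1)) (odd_two_mul_add_one p).neg (!a) (!a)) rfl rfl)) =
        LinkDiag.conway (LinkDiag.closure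
            (LinkDiag.oddTwist (2 * p + 1) (odd_two_mul_add_one p) c c)) *
          LinkDiag.conway (LinkDiag.closure
            (LinkDiag.oddTwist (-(2 * p + 1)) (odd_two_mul_add_one p).neg c' c')) *
          LinkDiag.conway (O.fill (LinkDiag.inftyAnti a)) ∧
      LinkDiag.conway (O.fill (LinkDiag.tangleSum
          (LinkDiag.oddTwist (2 * p + 1) (odd_two_mul_add_one p) a a)
          (LinkDiag.oddTwist (-(2 * p + 1)) (odd_two_mul_add_one p).neg (!a) (!a)) rfl rfl)) =
        LinkDiag.Psi p ^ 2 * LinkDiag.conway (O.fill (LinkDiag.inftyAnti a))) := by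
  refine ⟨fun O => ?_, fun O => ?_, fun O => ?_, fun O => ?_⟩
  · have h := LinkDiag.conway_sum_evenTwist_antiparallel p a O
      (LinkDiag.sumLayers_isTangle (LinkDiag.evenTwist (2 * p) (even_two_mul p) a (!a)).2
        (by rw [Bool.not_not]; exact (LinkDiag.evenTwist _ (even_two_mul p).neg a (!a)).2))
    have h1 := LinkDiag.conway_closure_evenTwist_antiparallel p c
      (LinkDiag.evenTwist _ (even_two_mul p) c (!c)).2
    have h2 := LinkDiag.conway_closure_evenTwist_antiparallel (-p) c'
      (LinkDiag.evenTwist _ (even_two_mul (-p)) c' (!c')).2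
    simp only [mul_neg, C_neg, neg_mul, neg_neg] at h2
    rw [LinkDiag.Outside.fill_tangleSum]
    refine ⟨h.trans (congrArg (· * _) ?_), h⟩
    refine Eq.trans ?_ (congrArg₂ (· * ·) h1 h2).symm
    ring
  · rw [LinkDiag.Outside.fill_tangleSum]
    exact LinkDiag.conway_sum_oddTwist_antiparallel p a O _
  · have h := (LinkDiag.conway_sum_parallel p a O).1
      (LinkDiag.sumLayers_isTangle (LinkDiag.evenTwist (2 * p) (even_two_mul p) a a).2
        (LinkDiag.evenTwist _ (even_two_mul p).neg (!a) (!a)).2)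
    have h1 := (LinkDiag.conway_closure_parallel p c).1
      (LinkDiag.evenTwist _ (even_two_mul p) c c).2
    have h2 := (LinkDiag.conway_closure_parallel (-p) c').1
      (LinkDiag.evenTwist _ (even_two_mul (-p)) c' c').2
    rw [(LinkDiag.Phi_neg_and_Psi_neg p).1] at h2
    simp only [mul_neg] at h2
    rw [LinkDiag.Outside.fill_tangleSum]
    refine ⟨h.trans (congrArg (· * _) ?_), h⟩
    refine Eq.trans ?_ (congrArg₂ (· * ·) h1 h2).symm
    ring
  · have h := (LinkDiag.conway_sum_parallel p a O).2
      (LinkDiag.sumLayers_isTangle (LinkDiag.oddTwist _ (odd_two_mul_add_one p) a a).2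
        (LinkDiag.oddTwist _ (odd_two_mul_add_one p).neg (!a) (!a)).2)
    have h1 := (LinkDiag.conway_closure_parallel p c).2
      (LinkDiag.oddTwist _ (odd_two_mul_add_one p) c c).2
    have h2 := (LinkDiag.conway_closure_parallel (-p - 1) c').2
      (LinkDiag.oddTwist _ (odd_two_mul_add_one (-p - 1)) c' c').2
    have e : 2 * (-p - 1) + 1 = -(2 * p + 1) := by ring
    simp only [(LinkDiag.Phi_neg_and_Psi_neg p).2, e] at h2
    rw [LinkDiag.Outside.fill_tangleSum]
    refine ⟨h.trans (congrArg (· * _) ?_), h⟩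
    refine Eq.trans ?_ (congrArg₂ (· * ·) h1 h2).symm
    ring
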